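/- Let $\mathcal X$ be a connected complete smooth (finite-dimensional, without boundary) Riemannian manifold with Riemannian distance $d$ and Riemannian volume $dx$. Let $V\in C^1(\mathcal X)$ be such that $Z=\int_{\mathcal X} e^{-V}\,dx<\infty$, and let $\mu=e^{-V}dx/Z$. Let $(\mathcal E,\mathbb D(\mathcal E))$ be the closure in $L^2(\mu)$ of the form $\mathcal E(g,g)=\int|\nabla g|^2\,d\mu$, $g\in C_0^\infty(\mathcal X)$ (smooth functions with compact support). For a probability measure $\nu$ on $\mathcal X$ put - $W_1(\nu,\mu)=\inf_\pi\iint d(x,y)\,\pi(dx,dy)\in[0,+\infty]$, the infimum being over all couplings $\pi$ of $(\nu,\mu)$; - $H(\nu|\mu)=\int \frac{d\nu}{d\mu}\log\frac{d\nu}{d\mu}\,d\mu$ if $\nu\ll\mu$, and $H(\nu|\mu)=+\infty$ otherwise; - $I(\nu|\mu)=\mathcal E(\sqrt f,\sqrt f)$ if $\nu=f\mu$ with $\sqrt f\in\mathbb D(\mathcal E)$, and $I(\nu|\mu)=+\infty$ otherwise. Let $\alpha:[0,+\infty)\to[0,+\infty]$ be a left-continuous, nondecreasing, convex function with $\alpha(0)=0$,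 and put $\tilde\alpha(r)=2\int_0^r\sqrt{\alpha(s)}\,ds$ for $r\ge0$. Nondecreasing functions on $[0,+\infty)$ are extended to $+\infty$ by their limit, and $e^{-\infty}=0$. Assume that $\mu$ satisfies $\alpha$-$W_1I$, that is, $\alpha(W_1(\nu,\mu))\le I(\nu|\mu)$ for every probability measure $\nu$ on $\mathcal X$. Then $$\tilde\alpha(W_1(\nu,\mu))\le H(\nu|\mu)\qquad\text{for every probability measure }\nu\text{ on }\mathcal X.$$ In particular, for every $g:\mathcal X\to\mathbb R$ that is $1$-Lipschitz with respect to $d$, $$\mu\big(g>\mu(g)+r\big)\le e^{-\tilde\alpha(r)}\qquad\text{for all } r>0,$$ where $\mu(g)=\int g\,d\mu$. Here $g$ is $\mu$-integrable as soon as $\alpha\not\equiv0$; if $\alpha\equiv0$, the right-hand side equals $1$ and the inequality is trivial. -/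

import Mathlib

open MeasureTheory Filter Manifold Bundle
open scoped ENNReal NNReal Topology ContDiff

noncomputable section

namespace TransportInformation

section Manifold

variable (n : ℕ) {M : Type*} [MetricSpace M] [ChartedSpace (EuclideanSpace ℝ (Fin n)) M]
  [RiemannianBundle (fun x : M => TangentSpace (𝓡 n) x)]

/-- The coordinate vector field `∂ᵢ` of the chart at `p`, at the point with coordinates `u`. -/
def coordVec (p : M) (u : EuclideanSpace ℝ (Fin n)) (i : Fin n) :
    TangentSpace (𝓡 n) ((extChartAt (𝓡 n) p).symm u) :=
  mfderiv (𝓡 n) (𝓡 n) (extChartAt (𝓡 n) p).symm u (EuclideanSpace.single i (1 : ℝ))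

/-- The density `√(det (g_ij))` of the Riemannian volume in the chart at `p`,
where `g_ij = ⟨∂ᵢ, ∂ⱼ⟩`. -/
def sqrtDetMetric (p : M) (u : EuclideanSpace ℝ (Fin n)) : ℝ :=
  √(Matrix.det (Matrix.of fun i j : Fin n =>
    inner ℝ (coordVec n p u i) (coordVec n p u j)))

/-- The Riemannian volume of the domain of the chart at `p`, that is `√(det (g_ij)) du`
transported to `M` by the inverse of the chart. -/
def chartVolume [MeasurableSpace M] (p : M) : Measure M :=
  (((volume : Measure (EuclideanSpace ℝ (Fin n))).restrict
      (extChartAt (𝓡 n) p).target).withDensity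
    (fun u => ENNReal.ofReal (sqrtDetMetric n p u))).map (extChartAt (𝓡 n) p).symm

/-- The Riemannian volume measure `dx`: the measure whose restriction to each chart domain is
`√(det (g_ij)) du`. The chart measures agree on overlaps and the charts cover `M`, so the
measure glued from them is their supremum. -/
def riemannianVolume (M : Type*) [MetricSpace M] [ChartedSpace (EuclideanSpace ℝ (Fin n)) M]
    [RiemannianBundle (fun x : M => TangentSpace (𝓡 n) x)] [MeasurableSpace M] : Measure M :=
  ⨆ p : M, chartVolume n p

/-- The normalization constant `Z = ∫ e^{-V} dx`. -/
def partitionFunction [MeasurableSpace M] (V : M → ℝ) : ℝ≥0∞ :=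
  ∫⁻ x, ENNReal.ofReal (Real.exp (-V x)) ∂(riemannianVolume n M)

/-- The measure `e^{-V} dx / Z`. -/
def gibbsMeasure [MeasurableSpace M] (V : M → ℝ) : Measure M :=
  (partitionFunction n V)⁻¹ •
    (riemannianVolume n M).withDensity (fun x => ENNReal.ofReal (Real.exp (-V x)))

/-- The length `|∇g|(x)` of the gradient, which is the norm of the differential `dg(x)` as a
linear form on the tangent space with its Riemannian inner product. -/
def gradNorm (g : M → ℝ) (x : M) : ℝ≥0∞ :=
  ‖mvfderiv (𝓡 n) g x‖ₑ

/-- `∫ |∇g|² dμ`, to be used for `g ∈ C_0^∞(M)`. -/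
def preEnergy [MeasurableSpace M] (μ : Measure M) (g : M → ℝ) : ℝ≥0∞ :=
  ∫⁻ x, gradNorm n g x ^ 2 ∂μ

/-- `φ` is a sequence in `C_0^∞(M)` which converges to `u` in `L²(μ)` and is Cauchy for the
pre-Dirichlet form. -/
structure IsApproximating [MeasurableSpace M] (μ : Measure M) (u : M → ℝ) (φ : ℕ → M → ℝ) :
    Prop where
  smooth : ∀ k, ContMDiff (𝓡 n) 𝓘(ℝ, ℝ) ∞ (φ k)
  compact : ∀ k, HasCompactSupport (φ k)
  tendsto_L2 : Tendsto (fun k => eLpNorm (fun x => φ k x - u x) 2 μ) atTop (𝓝 0)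
  cauchy : Tendsto (fun kl : ℕ × ℕ => preEnergy n μ (fun x => φ kl.1 x - φ kl.2 x)) atTop (𝓝 0)

/-- The domain `𝔻(ℰ)` of the closure of the form `∫ |∇g|² dμ`, `g ∈ C_0^∞(M)`, in `L²(μ)`. -/
def InFormDomain [MeasurableSpace M] (μ : Measure M) (u : M → ℝ) : Prop :=
  MemLp u 2 μ ∧ ∃ φ, IsApproximating n μ u φ

/-- The closed form `ℰ(u, u)`, `u ∈ 𝔻(ℰ)`: the limit of `∫ |∇φ_k|² dμ` along an approximating
sequence. For `μ = e^{-V} dx / Z` with `V` of class `C¹` the form is closable, so that the limit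
is the same for all approximating sequences and the infimum below is over one value. -/
def dirichletForm [MeasurableSpace M] (μ : Measure M) (u : M → ℝ) : ℝ≥0∞ :=
  sInf {c | ∃ φ, IsApproximating n μ u φ ∧
    Tendsto (fun k => preEnergy n μ (φ k)) atTop (𝓝 c)}

open scoped Classical in
/-- The Fisher information `I(ν|μ)`: it is `ℰ(√f, √f)` if `ν = f μ` with `√f ∈ 𝔻(ℰ)`,
and `+∞` otherwise. -/
def fisherInformation [MeasurableSpace M] (ν μ : Measure M) : ℝ≥0∞ :=
  if ν ≪ μ ∧ InFormDomain n μ (fun x => √(ν.rnDeriv μ x).toReal) then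
    dirichletForm n μ (fun x => √(ν.rnDeriv μ x).toReal)
  else ⊤

end Manifold

/-- The Wasserstein distance `W₁(ν, μ)`, the infimum of `∬ d(x, y) c(dx, dy)` over all
couplings `c` of `(ν, μ)`. -/
def wasserstein1 {M : Type*} [MetricSpace M] [MeasurableSpace M] (ν μ : Measure M) : ℝ≥0∞ :=
  ⨅ (c : Measure (M × M)) (_ : c.map Prod.fst = ν ∧ c.map Prod.snd = μ),
    ∫⁻ z, edist z.1 z.2 ∂c

/-- The value at `t ∈ [0, +∞]` of a nondecreasing function on `[0, +∞)`, with the usual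
convention `φ(+∞) = lim_{s → +∞} φ(s) = sup φ`. -/
def extendTop (φ : ℝ≥0 → ℝ≥0∞) (t : ℝ≥0∞) : ℝ≥0∞ :=
  if t = ⊤ then ⨆ s, φ s else φ t.toNNReal

/-- `α̃(r) = 2 ∫_0^r √(α(s)) ds`. -/
def alphaTilde (α : ℝ≥0 → ℝ≥0∞) (r : ℝ≥0) : ℝ≥0∞ :=
  2 * ∫⁻ s in Set.Ioc (0 : ℝ) r, α s.toNNReal ^ (1 / 2 : ℝ)

/-- The transport-information inequality `α-W₁I`: `α(W₁(ν, μ)) ≤ I(ν|μ)` for every probability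
measure `ν`. -/
def SatisfiesW1I (n : ℕ) {M : Type*} [MetricSpace M]
    [ChartedSpace (EuclideanSpace ℝ (Fin n)) M]
    [RiemannianBundle (fun x : M => TangentSpace (𝓡 n) x)] [MeasurableSpace M]
    (α : ℝ≥0 → ℝ≥0∞) (μ : Measure M) : Prop :=
  ∀ ν : Measure M, IsProbabilityMeasure ν →
    extendTop α (wasserstein1 ν μ) ≤ fisherInformation n ν μ

/-- The transport-entropy inequality `β-W₁H`: `β(W₁(ν, μ)) ≤ H(ν|μ)` for every probability
measure `ν`. The relative entropy `H` is the Kullback-Leibler divergence. -/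
def SatisfiesW1H {M : Type*} [MetricSpace M] [MeasurableSpace M]
    (β : ℝ≥0 → ℝ≥0∞) (μ : Measure M) : Prop :=
  ∀ ν : Measure M, IsProbabilityMeasure ν →
    extendTop β (wasserstein1 ν μ) ≤ InformationTheory.klDiv ν μ

end TransportInformation

end

/-! Fix a bounded 1-Lipschitz `g`; put m = μ(g) and K(l) = log ∫ e^{lg} dμ. The tilted measure μ_l =
e^{l g - K(l)} μ formally has I(μ_l|μ) = (l²/4) ∫ |∇g|² dμ_l ≤ l²/4, and K'(l) is its mean of `g`,
so that W₁(μ_l, μ) ≥ K'(l) - m. The transport-information inequality thus becomes a differential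
inequality for l ≥ 0: 2 √(α(K'(l) - m)) ≤ l wherever K'(l) > m (up to an arbitrarily small loss in
the argument, `le_of_lt_integral_tilted`). Integrating it is Young's inequality for 2√α and its
inverse, and gives α̃(r) ≤ sup_{l ≥ 0} (l(m + r) - K(l)) (`alphaTilde_le_of_forall_mul_sub_le`). By
Donsker-Varadhan, l ν(g) - K(l) ≤ H(ν|μ) for each l, hence α̃(r) ≤ H(ν|μ) once r < ν(g) - μ(g).
Kantorovich duality lets r increase to W₁(ν, μ), and α̃ is left-continuous.

The deviation inequality is the transport-entropy inequality for μ conditioned on A = {g > μ(g) +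
r}: its entropy is -log μ(A), and its distance to μ is at least r.

The analytic work comes from the fact that e^{lg/2} need not be a test function. Closed balls of a
complete Riemannian manifold are compact (Hopf-Rinow), so there are compactly supported cutoffs χ
with gradients O(1/k), and `g` is a uniform limit of smooth functions h with |∇h| ≤ 1 + ε. The
hypothesis is applied to the normalized squares of χ e^{lh/2}, and then the limit is taken.
Properness also enters the duality theorem, whose optimal coupling is produced by Hahn-Banach and
the Riesz representation theorem. -/

namespace TransportInformation

/-! ### Kantorovich duality on a proper metric space. -/

section Duality

open scoped BoundedContinuousFunction CompactlySupported

variable {X : Type*} [MetricSpace X]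

/-- A continuous cutoff, equal to `1` on a ball of radius `k - 1` and to `0` off that of
radius `k`. -/
def ballCutoff (x₀ : X) (k : ℕ) (x : X) : ℝ := max 0 (min 1 (k - dist x x₀))

lemma continuous_ballCutoff (x₀ : X) (k : ℕ) : Continuous (ballCutoff x₀ k) := by
  unfold ballCutoff; fun_prop

lemma ballCutoff_nonneg (x₀ : X) (k : ℕ) (x : X) : 0 ≤ ballCutoff x₀ k x := le_max_left _ _

lemma ballCutoff_le_one (x₀ : X) (k : ℕ) (x : X) : ballCutoff x₀ k x ≤ 1 :=
  max_le zero_le_one (min_le_left _ _)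

lemma ballCutoff_eq_zero {x₀ : X} {k : ℕ} {x : X} (h : k ≤ dist x x₀) : ballCutoff x₀ k x = 0 :=
  max_eq_left ((min_le_right _ _).trans (by linarith))

lemma tendsto_ballCutoff (x₀ x : X) :
    Tendsto (fun k => ballCutoff x₀ k x) atTop (𝓝 1) := by
  obtain ⟨m, hm⟩ := exists_nat_ge (dist x x₀ + 1)
  refine tendsto_atTop_of_eventually_const (i₀ := m) fun k hk => ?_
  have : (m : ℝ) ≤ k := by exact_mod_cast hk
  rw [ballCutoff, min_eq_left (by linarith), max_eq_right zero_le_one]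

/-- The product of a continuous function on `X × X` with a cutoff in both variables. -/
def cutoffMul [ProperSpace X] (x₀ : X) (k : ℕ) (F : C(X × X, ℝ)) : C_c(X × X, ℝ) where
  toFun z := ballCutoff x₀ k z.1 * ballCutoff x₀ k z.2 * F z
  continuous_toFun := by
    have := continuous_ballCutoff x₀ k
    fun_prop
  hasCompactSupport' := by
    refine HasCompactSupport.of_support_subset_isCompact
      ((isCompact_closedBall x₀ k).prod (isCompact_closedBall x₀ k)) fun z hz => ?_
    rw [Function.mem_support] at hz
    refine ⟨?_, ?_⟩ <;> rw [Metric.mem_closedBall] <;> by_contra! h <;>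
      simp [ballCutoff_eq_zero h.le] at hz

lemma cutoffMul_apply [ProperSpace X] (x₀ : X) (k : ℕ) (F : C(X × X, ℝ)) (z : X × X) :
    cutoffMul x₀ k F z = ballCutoff x₀ k z.1 * ballCutoff x₀ k z.2 * F z := rfl

variable [MeasurableSpace X]

/-- The costs of the dual plans `(φ, ψ, t)` such that `φ ⊕ ψ + t d` dominates `h`. -/
def dualCosts (ν μ : Measure X) (D : ℝ) (h : X × X → ℝ) : Set ℝ :=
  {r | ∃ φ ψ : X →ᵇ ℝ, ∃ t : ℝ, 0 ≤ t ∧ (∀ x y, h (x, y) ≤ φ x + ψ y + t * dist x y) ∧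
    r = ∫ x, φ x ∂ν + ∫ y, ψ y ∂μ + t * D}

lemma dualCosts_smul {ν μ : Measure X} {D : ℝ} {h : X × X → ℝ} {r c : ℝ} (hc : 0 < c)
    (hr : r ∈ dualCosts ν μ D h) : c * r ∈ dualCosts ν μ D (c • h) := by
  obtain ⟨φ, ψ, t, ht, hle, rfl⟩ := hr
  refine ⟨c • φ, c • ψ, c * t, by positivity, fun x y => ?_, ?_⟩
  · have := mul_le_mul_of_nonneg_left (hle x y) hc.le
    simp only [Pi.smul_apply, smul_eq_mul, BoundedContinuousFunction.coe_smul]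
    linarith
  · simp only [BoundedContinuousFunction.coe_smul, smul_eq_mul, integral_const_mul]
    ring

variable [BorelSpace X]

lemma dualCosts_add {ν μ : Measure X} [IsProbabilityMeasure ν] [IsProbabilityMeasure μ] {D : ℝ}
    {h h' : X × X → ℝ} {r r' : ℝ} (hr : r ∈ dualCosts ν μ D h) (hr' : r' ∈ dualCosts ν μ D h') :
    r + r' ∈ dualCosts ν μ D (h + h') := by
  obtain ⟨φ, ψ, t, ht, hle, rfl⟩ := hr
  obtain ⟨φ', ψ', t', ht', hle', rfl⟩ := hr'
  refine ⟨φ + φ', ψ + ψ', t + t', by positivity, fun x y => ?_, ?_⟩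
  · have h1 := hle x y
    have h2 := hle' x y
    simp only [Pi.add_apply, BoundedContinuousFunction.coe_add]
    linarith
  · simp only [BoundedContinuousFunction.coe_add, Pi.add_apply]
    rw [integral_add (φ.integrable ν) (φ'.integrable ν),
      integral_add (ψ.integrable μ) (ψ'.integrable μ)]
    ring

/-- If `φ ⊕ ψ ≤ d`, replacing `φ` by the `1`-Lipschitz function `inf_y (d(·, y) - ψ(y))` bounds
the dual cost by that of a `1`-Lipschitz function. -/
lemma dual_le_of_lipschitz {ν μ : Measure X} [IsProbabilityMeasure ν] [IsProbabilityMeasure μ]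
    {D : ℝ} (hD : ∀ g : X →ᵇ ℝ, LipschitzWith 1 g → ∫ x, g x ∂ν - ∫ x, g x ∂μ ≤ D)
    (φ ψ : X →ᵇ ℝ) (h : ∀ x y, φ x + ψ y ≤ dist x y) :
    ∫ x, φ x ∂ν + ∫ y, ψ y ∂μ ≤ D := by
  have hne : Nonempty X := nonempty_of_isProbabilityMeasure ν
  let G : X → ℝ := fun x => ⨅ y, (dist x y - ψ y)
  have hbdd : ∀ x, BddBelow (Set.range fun y => dist x y - ψ y) := fun x =>
    ⟨φ x, by rintro _ ⟨y, rfl⟩; linarith [h x y]⟩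
  have h1 : ∀ x, φ x ≤ G x := fun x => le_ciInf fun y => by linarith [h x y]
  have h2 : ∀ x, G x ≤ -ψ x := fun x => (ciInf_le (hbdd x) x).trans (by simp)
  have hL : LipschitzWith 1 G := LipschitzWith.of_le_add fun x y => by
    rw [← sub_le_iff_le_add]
    refine le_ciInf fun z => ?_
    have := ciInf_le (hbdd x) z
    linarith [dist_triangle x y z]
  let g : X →ᵇ ℝ := BoundedContinuousFunction.ofNormedAddCommGroup G hL.continuous
    (‖φ‖ + ‖ψ‖) fun x => by
      have a1 := abs_le.1 (φ.norm_coe_le_norm x)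
      have a2 := abs_le.1 (ψ.norm_coe_le_norm x)
      rw [Real.norm_eq_abs, abs_le]
      constructor <;> linarith [h1 x, h2 x, norm_nonneg φ, norm_nonneg ψ]
  have key := hD g hL
  have e1 : ∫ x, φ x ∂ν ≤ ∫ x, g x ∂ν := integral_mono (φ.integrable ν) (g.integrable ν) h1
  have e2 : ∫ x, g x ∂μ ≤ -∫ x, ψ x ∂μ := by
    rw [← integral_neg]
    exact integral_mono (g.integrable μ) (ψ.integrable μ).neg h2
  linarith

/-- This makes the infimum of the dual costs finite and nonnegative at `h = 0`, as Hahn-Banach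
requires. For t > 0, divide by t: the negatives of (φ - C)/t and ψ/t form an admissible pair for the
cost d. For t = 0 it suffices to integrate in each variable. -/
lemma dualCosts_lower_bound {ν μ : Measure X} [IsProbabilityMeasure ν] [IsProbabilityMeasure μ]
    {D : ℝ} (hD : ∀ g : X →ᵇ ℝ, LipschitzWith 1 g → ∫ x, g x ∂ν - ∫ x, g x ∂μ ≤ D)
    {h : X × X → ℝ} {C : ℝ} (hC : ∀ z, C ≤ h z) {r : ℝ} (hr : r ∈ dualCosts ν μ D h) : C ≤ r := by
  obtain ⟨φ, ψ, t, ht, hle, rfl⟩ := hr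
  have hle' : ∀ x y, 0 ≤ (φ x - C) + ψ y + t * dist x y := fun x y => by
    linarith [hle x y, hC (x, y)]
  have hφ : ∫ x, (φ x - C) ∂ν = ∫ x, φ x ∂ν - C := by
    rw [integral_sub (φ.integrable ν) (integrable_const _)]; simp
  rcases ht.eq_or_lt with rfl | ht
  · have hne : Nonempty X := nonempty_of_isProbabilityMeasure ν
    have : ∀ x, 0 ≤ (φ x - C) + ∫ y, ψ y ∂μ := fun x => by
      have : ∫ y, -(φ x - C) ∂μ ≤ ∫ y, ψ y ∂μ :=
        integral_mono (integrable_const _) (ψ.integrable μ) fun y => by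
          have := hle' x y
          simp only [zero_mul, add_zero] at this
          linarith
      simp only [integral_const, probReal_univ, one_smul] at this
      linarith
    have : ∫ x, -(∫ y, ψ y ∂μ) ∂ν ≤ ∫ x, (φ x - C) ∂ν :=
      integral_mono (integrable_const _) ((φ.integrable ν).sub (integrable_const _)) fun x => by
        have := this x
        simp only
        linarith
    simp only [integral_const, probReal_univ, one_smul] at this
    linarith
  · have := dual_le_of_lipschitz hD (-(t⁻¹ • (φ - BoundedContinuousFunction.const X C)))
      (-(t⁻¹ • ψ)) fun x y => by
        have := mul_nonneg (inv_nonneg.2 ht.le) (hle' x y)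
        rw [mul_add, inv_mul_cancel_left₀ ht.ne'] at this
        simp only [BoundedContinuousFunction.coe_neg, BoundedContinuousFunction.coe_smul,
          BoundedContinuousFunction.coe_sub, Pi.neg_apply, Pi.sub_apply,
          BoundedContinuousFunction.const_apply, smul_eq_mul]
        linarith
    simp only [BoundedContinuousFunction.coe_neg, BoundedContinuousFunction.coe_smul,
      BoundedContinuousFunction.coe_sub, Pi.neg_apply, Pi.sub_apply,
      BoundedContinuousFunction.const_apply, smul_eq_mul, integral_neg, integral_const_mul,
      hφ] at this
    have := mul_le_mul_of_nonneg_left this ht.le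
    rw [mul_add, mul_neg, mul_neg, mul_inv_cancel_left₀ ht.ne', mul_inv_cancel_left₀ ht.ne'] at this
    linarith

/-- The infimum of the dual costs is a sublinear functional of `h`, so Hahn-Banach extends the zero
functional on the zero subspace to a linear functional below it. This functional will be integration
against a coupling. -/
lemma exists_dual_functional [ProperSpace X] {ν μ : Measure X} [IsProbabilityMeasure ν]
    [IsProbabilityMeasure μ] {D : ℝ}
    (hD : ∀ g : X →ᵇ ℝ, LipschitzWith 1 g → ∫ x, g x ∂ν - ∫ x, g x ∂μ ≤ D) :
    ∃ Λ : C_c(X × X, ℝ) →ₗ[ℝ] ℝ, ∀ h : C_c(X × X, ℝ), ∀ r ∈ dualCosts ν μ D h, Λ h ≤ r := by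
  let S : C_c(X × X, ℝ) → Set ℝ := fun h => dualCosts ν μ D h
  have hbound : ∀ h : C_c(X × X, ℝ), ∃ C, ∀ z, |h z| ≤ C := fun h => by
    obtain ⟨C, hC⟩ := h.hasCompactSupport'.exists_bound_of_continuous h.continuous_toFun
    exact ⟨C, hC⟩
  have hbdd : ∀ h, BddBelow (S h) := fun h => by
    obtain ⟨C, hC⟩ := hbound h
    exact ⟨-C, fun r hr => dualCosts_lower_bound hD (fun z => (abs_le.1 (hC z)).1) hr⟩
  have hne : ∀ h, (S h).Nonempty := fun h => by
    obtain ⟨C, hC⟩ := hbound h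
    refine ⟨_, BoundedContinuousFunction.const X C, 0, 0, le_rfl, fun x y => ?_, rfl⟩
    simpa using (abs_le.1 (hC (x, y))).2
  have hsmul : ∀ c : ℝ, 0 < c → ∀ h, sInf (S (c • h)) ≤ c * sInf (S h) := fun c hc h => by
    rw [← div_le_iff₀' hc]
    refine le_csInf (hne h) fun r hr => ?_
    rw [div_le_iff₀' hc]
    exact csInf_le (hbdd _) (dualCosts_smul hc hr)
  have key := exists_extension_of_le_sublinear (⊥ : C_c(X × X, ℝ) →ₗ.[ℝ] ℝ)
    (fun h => sInf (S h)) ?_ ?_ ?_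
  · obtain ⟨Λ, -, hΛ⟩ := key
    exact ⟨Λ, fun h r hr => (hΛ h).trans (csInf_le (hbdd h) hr)⟩
  · intro c hc h
    refine le_antisymm (hsmul c hc h) ?_
    have := hsmul c⁻¹ (inv_pos.2 hc) (c • h)
    rw [inv_smul_smul₀ hc.ne'] at this
    rw [← le_div_iff₀' hc, div_eq_inv_mul]
    exact this
  · intro h h'
    rw [← sub_le_iff_le_add]
    refine le_csInf (hne h) fun r hr => ?_
    rw [sub_le_iff_le_add, ← sub_le_iff_le_add']
    refine le_csInf (hne h') fun r' hr' => ?_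
    rw [sub_le_iff_le_add, add_comm r']
    exact csInf_le (hbdd _) (dualCosts_add hr hr')
  · rintro ⟨x, hx⟩
    obtain rfl : x = 0 := (Submodule.mem_bot ℝ).1 hx
    have : (0 : ℝ) ≤ sInf (S 0) :=
      le_csInf (hne 0) fun r hr => dualCosts_lower_bound hD (fun z => by simp) hr
    exact this.trans' (le_of_eq (LinearPMap.map_zero _))

/-- The inequality for c - f, with c a bound of f, is the reverse inequality for f, because the
total masses agree. -/
lemma measure_eq_of_lintegral_le {ν ν' : Measure X} [IsProbabilityMeasure ν]
    [IsProbabilityMeasure ν'] (h : ∀ f : X →ᵇ ℝ≥0, ∫⁻ x, f x ∂ν ≤ ∫⁻ x, f x ∂ν') : ν = ν' := by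
  refine ext_of_forall_lintegral_eq_of_IsFiniteMeasure fun f => le_antisymm (h f) ?_
  let c : ℝ≥0 := nndist f 0
  have hfc : ∀ x, f x ≤ c := fun x => by
    have := f.dist_coe_le_dist (g := 0) x
    simpa [NNReal.dist_eq, c, ← NNReal.coe_le_coe] using this
  have key := h (BoundedContinuousFunction.const X c - f)
  have hsum : ∀ ρ : Measure X, IsProbabilityMeasure ρ → ∫⁻ x, f x ∂ρ +
      ∫⁻ x, (BoundedContinuousFunction.const X c - f) x ∂ρ = c := fun ρ _ => by
    rw [← lintegral_add_left (by fun_prop)]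
    have : ∀ x, (f x : ℝ≥0∞) + (BoundedContinuousFunction.const X c - f : X →ᵇ ℝ≥0) x = c :=
      fun x => by
        rw [← ENNReal.coe_add]
        congr 1
        exact add_tsub_cancel_of_le (hfc x)
    rw [lintegral_congr this]
    simp
  have hfin : ∫⁻ x, (BoundedContinuousFunction.const X c - f) x ∂ν' ≠ ⊤ :=
    ((le_add_self.trans_eq (hsum ν' inferInstance)).trans_lt ENNReal.coe_lt_top).ne
  refine (ENNReal.add_le_add_iff_right hfin).1 ?_
  rw [hsum ν' inferInstance, ← hsum ν inferInstance]
  gcongr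

lemma exists_realValued_of_nnreal (f : X →ᵇ ℝ≥0) : ∃ f' : X →ᵇ ℝ, (∀ x, f' x = f x) ∧
    ∀ ρ : Measure X, ∫ x, f' x ∂ρ = (∫⁻ x, f x ∂ρ).toReal := by
  refine ⟨BoundedContinuousFunction.ofNormedAddCommGroup (fun x => (f x : ℝ)) (by fun_prop)
    (nndist f 0) fun x => ?_, fun x => rfl, fun ρ => ?_⟩
  · have := f.dist_coe_le_dist (g := 0) x
    simpa [NNReal.dist_eq] using this
  · simp only [BoundedContinuousFunction.coe_ofNormedAddCommGroup]
    rw [integral_eq_lintegral_of_nonneg_ae (Eventually.of_forall fun x => NNReal.coe_nonneg _)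
      (NNReal.continuous_coe.comp f.continuous).aestronglyMeasurable]
    simp

/-- **Kantorovich duality** on a proper metric space: the Wasserstein distance is bounded by the
supremum of `∫ g dν - ∫ g dμ` over bounded `1`-Lipschitz functions. -/
theorem wasserstein1_le_of_forall_lipschitz [ProperSpace X] {ν μ : Measure X}
    [IsProbabilityMeasure ν] [IsProbabilityMeasure μ] {D : ℝ}
    (hD : ∀ g : X →ᵇ ℝ, LipschitzWith 1 g → ∫ x, g x ∂ν - ∫ x, g x ∂μ ≤ D) :
    wasserstein1 ν μ ≤ ENNReal.ofReal D := by
  have hne : Nonempty X := nonempty_of_isProbabilityMeasure ν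
  obtain ⟨x₀⟩ := hne
  obtain ⟨L, hL⟩ := exists_dual_functional hD
  let Λ : C_c(X × X, ℝ) →ₚ[ℝ] ℝ := PositiveLinearMap.mk₀ L fun h hh => by
    -- For h ≥ 0 the zero plan dominates -h at cost 0, so the functional is positive.
    have : L (-h) ≤ 0 := hL _ _ ⟨0, 0, 0, le_rfl, fun x y => by
      have := hh (x, y)
      simpa using this, by simp⟩
    simpa using this
  let γ := RealRMK.rieszMeasure Λ
  have hγ : ∀ h : C_c(X × X, ℝ), ∫ z, h z ∂γ = L h := RealRMK.integral_rieszMeasure Λ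
  -- The domination by dual costs passes from compactly supported functions to all nonnegative
  -- continuous ones, by cutoffs and Fatou.
  have hupper : ∀ F : C(X × X, ℝ), (∀ z, 0 ≤ F z) → ∀ r ∈ dualCosts ν μ D F,
      ∫⁻ z, ENNReal.ofReal (F z) ∂γ ≤ ENNReal.ofReal r := by
    rintro F hF r ⟨φ, ψ, t, ht, hle, rfl⟩
    have hcut : ∀ k z, 0 ≤ cutoffMul x₀ k F z ∧ cutoffMul x₀ k F z ≤ F z := fun k z => by
      have h1 := ballCutoff_nonneg x₀ k z.1
      have h2 := ballCutoff_nonneg x₀ k z.2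
      have h3 := ballCutoff_le_one x₀ k z.1
      have h4 := ballCutoff_le_one x₀ k z.2
      rw [cutoffMul_apply]
      exact ⟨mul_nonneg (mul_nonneg h1 h2) (hF z),
        mul_le_of_le_one_left (hF z) (mul_le_one₀ h3 h2 h4)⟩
    calc ∫⁻ z, ENNReal.ofReal (F z) ∂γ
        = ∫⁻ z, liminf (fun k => ENNReal.ofReal (cutoffMul x₀ k F z)) atTop ∂γ := by
          refine lintegral_congr fun z => ?_
          have : Tendsto (fun k => cutoffMul x₀ k F z) atTop (𝓝 (1 * 1 * F z)) :=
            ((tendsto_ballCutoff x₀ z.1).mul (tendsto_ballCutoff x₀ z.2)).mul_const _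
          simp only [one_mul] at this
          exact ((ENNReal.continuous_ofReal.tendsto _).comp this).liminf_eq.symm
      _ ≤ liminf (fun k => ∫⁻ z, ENNReal.ofReal (cutoffMul x₀ k F z) ∂γ) atTop :=
          lintegral_liminf_le fun k =>
            ((cutoffMul x₀ k F).continuous_toFun.measurable).ennreal_ofReal
      _ ≤ ENNReal.ofReal _ := by
          refine liminf_le_of_le (by isBoundedDefault) fun b hb => ?_
          obtain ⟨k, hk⟩ := hb.exists
          refine hk.trans ?_
          rw [← ofReal_integral_eq_lintegral_ofReal (cutoffMul x₀ k F).integrable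
            (Eventually.of_forall fun z => (hcut k z).1), hγ]
          exact ENNReal.ofReal_le_ofReal
            (hL _ _ ⟨φ, ψ, t, ht, fun x y => (hcut k (x, y)).2.trans (hle x y), rfl⟩)
  have hmass : γ Set.univ ≤ 1 := by
    have := hupper 1 (fun _ => zero_le_one) 1
      ⟨1, 0, 0, le_rfl, fun x y => by simp, by simp⟩
    simpa using this
  have : IsFiniteMeasure γ := ⟨hmass.trans_lt ENNReal.one_lt_top⟩
  -- No mass escapes to infinity. If a, b are the cutoff values at x, y, then (1 - a)(1 - b) ≥ 0
  -- says -ab ≤ ((1 - a) - 1) + (1 - b), a dual plan for minus the cutoff whose cost tends to -1.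
  have hmass' : 1 ≤ γ.real Set.univ := by
    have hcutlim : ∀ ρ : Measure X, IsProbabilityMeasure ρ →
        Tendsto (fun k => ∫ x, (1 - ballCutoff x₀ k x) ∂ρ) atTop (𝓝 0) := fun ρ _ => by
      have := tendsto_integral_of_dominated_convergence (μ := ρ)
        (F := fun k x => 1 - ballCutoff x₀ k x) (f := fun _ => 0) (fun _ => (1 : ℝ))
        (fun k => (continuous_const.sub (continuous_ballCutoff x₀ k)).aestronglyMeasurable)
        (integrable_const _)
        (fun k => Eventually.of_forall fun x => by
          rw [Real.norm_eq_abs, abs_le]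
          constructor <;> linarith [ballCutoff_nonneg x₀ k x, ballCutoff_le_one x₀ k x])
        (Eventually.of_forall fun x => by simpa using (tendsto_ballCutoff x₀ x).const_sub 1)
      simpa using this
    have hlim : Tendsto (fun k => 1 - (∫ x, (1 - ballCutoff x₀ k x) ∂ν +
        ∫ x, (1 - ballCutoff x₀ k x) ∂μ)) atTop (𝓝 1) := by
      simpa using ((hcutlim ν inferInstance).add (hcutlim μ inferInstance)).const_sub 1
    refine le_of_tendsto hlim (Eventually.of_forall fun k => ?_)
    let χ : X →ᵇ ℝ := BoundedContinuousFunction.ofNormedAddCommGroup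
      (fun x => 1 - ballCutoff x₀ k x) (continuous_const.sub (continuous_ballCutoff x₀ k)) 1
      fun x => by
        rw [Real.norm_eq_abs, abs_le]
        constructor <;> linarith [ballCutoff_nonneg x₀ k x, ballCutoff_le_one x₀ k x]
    have h1 := hL (-cutoffMul x₀ k 1) _ ⟨χ - 1, χ, 0, le_rfl, fun x y => by
      have h1 := ballCutoff_le_one x₀ k x
      have h2 := ballCutoff_le_one x₀ k y
      simp only [CompactlySupportedContinuousMap.coe_neg, Pi.neg_apply, cutoffMul_apply,
        ContinuousMap.one_apply, BoundedContinuousFunction.coe_sub, Pi.sub_apply,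
        BoundedContinuousFunction.coe_one, Pi.one_apply, χ,
        BoundedContinuousFunction.coe_ofNormedAddCommGroup]
      nlinarith, rfl⟩
    have h2 : ∫ x, (χ - 1 : X →ᵇ ℝ) x ∂ν = ∫ x, (1 - ballCutoff x₀ k x) ∂ν - 1 := by
      have := integral_sub (χ.integrable ν) (integrable_const (1 : ℝ))
      simpa [χ] using this
    rw [map_neg, ← hγ, h2] at h1
    have h3 : ∫ z, cutoffMul x₀ k 1 z ∂γ ≤ ∫ z, (1 : ℝ) ∂γ := by
      refine integral_mono (cutoffMul x₀ k 1).integrable (integrable_const _) fun z => ?_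
      simp only [cutoffMul_apply, ContinuousMap.one_apply, mul_one]
      exact mul_le_one₀ (ballCutoff_le_one _ _ _) (ballCutoff_nonneg _ _ _)
        (ballCutoff_le_one _ _ _)
    have h4 : ∫ x, χ x ∂μ = ∫ x, (1 - ballCutoff x₀ k x) ∂μ := rfl
    simp only [integral_const, smul_eq_mul, mul_one] at h3
    linarith
  have hprob : IsProbabilityMeasure γ := ⟨le_antisymm hmass (by
    rw [← ENNReal.ofReal_toReal (measure_ne_top γ Set.univ), ← ENNReal.ofReal_one]
    exact ENNReal.ofReal_le_ofReal hmass')⟩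
  have hfst : γ.map Prod.fst = ν := by
    have := Measure.isProbabilityMeasure_map (μ := γ) measurable_fst.aemeasurable
    refine measure_eq_of_lintegral_le fun f => ?_
    rw [lintegral_map (by fun_prop) measurable_fst]
    obtain ⟨f', hf', hint⟩ := exists_realValued_of_nnreal f
    have := hupper ⟨fun z => f z.1, by fun_prop⟩ (fun z => (f z.1).2) _
      ⟨f', 0, 0, le_rfl, fun x y => by simp [hf'], rfl⟩
    simpa [hint, ENNReal.ofReal_toReal (f.lintegral_lt_top_of_nnreal ν).ne] using this
  have hsnd : γ.map Prod.snd = μ := by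
    have := Measure.isProbabilityMeasure_map (μ := γ) measurable_snd.aemeasurable
    refine measure_eq_of_lintegral_le fun f => ?_
    rw [lintegral_map (by fun_prop) measurable_snd]
    obtain ⟨f', hf', hint⟩ := exists_realValued_of_nnreal f
    have := hupper ⟨fun z => f z.2, by fun_prop⟩ (fun z => (f z.2).2) _
      ⟨0, f', 0, le_rfl, fun x y => by simp [hf'], rfl⟩
    simpa [hint, ENNReal.ofReal_toReal (f.lintegral_lt_top_of_nnreal μ).ne] using this
  refine (iInf₂_le γ ⟨hfst, hsnd⟩).trans ?_
  -- The plan φ = ψ = 0, t = 1 dominates d itself, at cost `D`.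
  have := hupper ⟨fun z => dist z.1 z.2, by fun_prop⟩ (fun z => dist_nonneg) D
    ⟨0, 0, 1, zero_le_one, fun x y => by simp, by simp⟩
  simpa [edist_dist] using this

end Duality

/-! ### Compactness of closed balls. -/

section HopfRinow

/-- Points at prescribed distance on almost shortest curves exist in a length space. -/
def HasApproxIntermediatePoints (X : Type*) [MetricSpace X] : Prop :=
  ∀ x y : X, ∀ s ε : ℝ, 0 ≤ s → s ≤ dist x y → 0 < ε →
    ∃ z, dist x z ≤ s ∧ dist z y ≤ dist x y - s + ε

/-- By the intermediate value theorem, a curve from x to y of length less than d(x, y) + ε meets the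
sphere of radius s around x; the remaining piece then has length at most d(x, y) - s + ε. -/
lemma hasApproxIntermediatePoints_of_isRiemannianManifold
    {E : Type*} [NormedAddCommGroup E] [NormedSpace ℝ E] {H : Type*} [TopologicalSpace H]
    (I : ModelWithCorners ℝ E H) {M : Type*} [MetricSpace M] [ChartedSpace H M]
    [RiemannianBundle (fun x : M => TangentSpace I x)] [IsRiemannianManifold I M] :
    HasApproxIntermediatePoints M := by
  intro x y s ε hs hsd hε
  have hlt : riemannianEDist I x y < edist x y + ENNReal.ofReal ε := by
    rw [← IsRiemannianManifold.out (I := I) x y]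
    exact ENNReal.lt_add_right (edist_ne_top x y) (by simpa using hε)
  obtain ⟨γ, h0, h1, hγ, hlen⟩ := exists_lt_of_riemannianEDist_lt hlt
  have hcont : ContinuousOn (fun t => dist x (γ t)) (Set.Icc 0 1) :=
    Continuous.comp_continuousOn (by fun_prop : Continuous fun p => dist x p) hγ.continuousOn
  obtain ⟨t, ht, hts⟩ : s ∈ (fun t => dist x (γ t)) '' Set.Icc 0 1 :=
    intermediate_value_Icc zero_le_one hcont ⟨by simpa [h0] using hs, by simpa [h1] using hsd⟩
  simp only at hts
  refine ⟨γ t, hts.le, ?_⟩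
  have e1 : edist x (γ t) ≤ pathELength I γ 0 t := by
    rw [IsRiemannianManifold.out (I := I)]
    exact riemannianEDist_le_pathELength (hγ.mono (Set.Icc_subset_Icc le_rfl ht.2)) h0 rfl ht.1
  have e2 : edist (γ t) y ≤ pathELength I γ t 1 := by
    rw [IsRiemannianManifold.out (I := I)]
    exact riemannianEDist_le_pathELength (hγ.mono (Set.Icc_subset_Icc ht.1 le_rfl)) rfl h1 ht.2
  have e3 : edist x (γ t) + edist (γ t) y ≤ edist x y + ENNReal.ofReal ε :=
    ((add_le_add e1 e2).trans_eq (pathELength_add ht.1 ht.2)).trans hlen.le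
  simp only [edist_dist] at e3
  rw [← ENNReal.ofReal_add dist_nonneg dist_nonneg, ← ENNReal.ofReal_add dist_nonneg hε.le,
    ENNReal.ofReal_le_ofReal_iff (by positivity)] at e3
  linarith

/-- **Hopf-Rinow** (the Cohn-Vossen form): a complete locally compact length space is proper. -/
theorem properSpace_of_hasApproxIntermediatePoints {X : Type*} [MetricSpace X] [CompleteSpace X]
    [LocallyCompactSpace X] (h : HasApproxIntermediatePoints X) : ProperSpace X := by
  refine ⟨fun x₀ r => ?_⟩
  by_contra hr
  let S : Set ℝ := {r | IsCompact (Metric.closedBall x₀ r)}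
  have hmono : ∀ a b, a ≤ b → b ∈ S → a ∈ S := fun a b hab hb =>
    IsCompact.of_isClosed_subset hb Metric.isClosed_closedBall (Metric.closedBall_subset_closedBall hab)
  have hlt : ∀ s ∈ S, s < r := fun s hs => not_le.1 fun hrs => hr (hmono r s hrs hs)
  have h0 : (0 : ℝ) ∈ S := by simp [S]
  have hbdd : BddAbove S := ⟨r, fun s hs => (hlt s hs).le⟩
  set R := sSup S with hR
  have hR0 : 0 ≤ R := le_csSup hbdd h0
  -- The supremum of the compact radii is attained: every point of the ball of radius `R` is within
  -- ε/2 of a slightly smaller, compact ball, so an ε/4-net of the latter is an ε-net of the former.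
  have hRS : R ∈ S := by
    change IsCompact _
    rw [isCompact_iff_totallyBounded_isComplete]
    refine ⟨?_, Metric.isClosed_closedBall.isComplete⟩
    rw [Metric.totallyBounded_iff]
    intro ε hε
    rcases hR0.eq_or_lt with h0' | hRpos
    · refine ⟨{x₀}, Set.finite_singleton _, fun y hy => ?_⟩
      rw [← h0', Metric.closedBall_zero, Set.mem_singleton_iff] at hy
      simpa [hy] using hε
    obtain ⟨s, hs0, hsR, hsε⟩ : ∃ s, 0 ≤ s ∧ s < R ∧ R - ε / 4 ≤ s :=
      ⟨max 0 (R - ε / 4), le_max_left _ _, max_lt hRpos (by linarith), le_max_right _ _⟩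
    have hsS : IsCompact (Metric.closedBall x₀ s) := by
      obtain ⟨b, hb, hsb⟩ := exists_lt_of_lt_csSup ⟨0, h0⟩ hsR
      exact hmono s b hsb.le hb
    obtain ⟨t, ht, hcov⟩ := Metric.totallyBounded_iff.1 hsS.totallyBounded (ε / 4) (by linarith)
    refine ⟨t, ht, fun y hy => ?_⟩
    rw [Metric.mem_closedBall'] at hy
    obtain ⟨z, hz1, hz2⟩ : ∃ z, dist x₀ z ≤ s ∧ dist z y ≤ ε / 2 := by
      rcases le_total (dist x₀ y) s with hys | hys
      · exact ⟨y, hys, by rw [dist_self]; linarith⟩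
      · obtain ⟨z, hz1, hz2⟩ := h x₀ y s (ε / 4) hs0 hys (by linarith)
        exact ⟨z, hz1, by linarith⟩
    obtain ⟨p, hp, hzp⟩ := Set.mem_iUnion₂.1 (hcov (Metric.mem_closedBall'.2 hz1))
    rw [Metric.mem_ball] at hzp
    refine Set.mem_iUnion₂.2 ⟨p, hp, ?_⟩
    rw [Metric.mem_ball]
    linarith [dist_triangle y z p, dist_comm y z]
  -- Local compactness thickens the compact ball, which contradicts the maximality of `R`.
  obtain ⟨δ, hδ, hthick⟩ := IsCompact.exists_isCompact_cthickening hRS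
  have : R + δ / 2 ∈ S := by
    refine IsCompact.of_isClosed_subset hthick Metric.isClosed_closedBall fun y hy => ?_
    rw [Metric.mem_closedBall'] at hy
    rcases le_total (dist x₀ y) R with hyR | hyR
    · exact Metric.self_subset_cthickening _ (Metric.mem_closedBall'.2 hyR)
    · obtain ⟨z, hz1, hz2⟩ := h x₀ y R (δ / 2) hR0 hyR (by linarith)
      exact Metric.mem_cthickening_of_dist_le y z δ _ (Metric.mem_closedBall'.2 hz1)
        (by rw [dist_comm]; linarith)
  linarith [le_csSup hbdd this]

end HopfRinow

/-! ### Mollification in a vector space. -/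

section Mollification

open scoped Convolution

variable {E : Type*} [NormedAddCommGroup E] [NormedSpace ℝ E] [FiniteDimensional ℝ E]

omit [FiniteDimensional ℝ E] in
-- A seminorm replaces the norm because the Riemannian metric at a point, read in a chart, is not a
-- multiple of the Euclidean one, and the constant 1 must not be lost.
lemma abs_fderiv_le_of_seminorm (p : Seminorm ℝ E) {F : E → ℝ} {u : E}
    (hF : DifferentiableAt ℝ F u) (h : ∀ᶠ u' in 𝓝 u, |F u' - F u| ≤ p (u' - u)) (w : E) :
    |fderiv ℝ F u w| ≤ p w := by
  have hd : HasDerivAt (fun t : ℝ => F (u + t • w)) (fderiv ℝ F u w) 0 := by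
    have h1 : HasDerivAt (fun t : ℝ => u + t • w) w 0 := by
      simpa using ((hasDerivAt_id (0 : ℝ)).smul_const w).const_add u
    have h2 : HasFDerivAt F (fderiv ℝ F u) (u + (0 : ℝ) • w) := by simpa using hF.hasFDerivAt
    exact h2.comp_hasDerivAt (0 : ℝ) h1
  refine hd.le_of_lip' (apply_nonneg p w) ?_
  have hc : Tendsto (fun t : ℝ => u + t • w) (𝓝 0) (𝓝 u) := by
    have : Continuous (fun t : ℝ => u + t • w) := by fun_prop
    simpa using this.tendsto 0
  filter_upwards [hc.eventually h] with t ht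
  rw [add_sub_cancel_left, map_smul_eq_mul] at ht
  simpa [mul_comm] using ht

/-- Mollification of a function which is Lipschitz on a ball for a seminorm: the mollified
function has the same Lipschitz constant on the ball of half radius. -/
lemma exists_contDiff_approx_of_seminorm_lipschitz (p : Seminorm ℝ E) {C : ℝ≥0}
    (hp : ∀ w, p w ≤ C * ‖w‖) {f : E → ℝ} {c : E} {ρ : ℝ} (hρ : 0 < ρ)
    (hf : ∀ u ∈ Metric.ball c ρ, ∀ u' ∈ Metric.ball c ρ, |f u - f u'| ≤ p (u - u'))
    {ε : ℝ} (hε : 0 < ε) :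
    ∃ F : E → ℝ, ContDiff ℝ ∞ F ∧ ∀ u ∈ Metric.ball c (ρ / 2),
      |F u - f u| ≤ ε ∧ ∀ w, |fderiv ℝ F u w| ≤ p w := by
  borelize E
  let m : Measure E := Measure.addHaar
  -- The global Lipschitz extension only serves to define the convolution; its constant `C` enters
  -- the uniform error but not the derivative bound.
  obtain ⟨f', hf'L, hf'⟩ : ∃ f', LipschitzWith C f' ∧ Set.EqOn f f' (Metric.ball c ρ) := by
    refine LipschitzOnWith.extend_real (LipschitzOnWith.of_dist_le_mul fun u hu u' hu' => ?_)
    rw [Real.dist_eq, dist_eq_norm]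
    exact (hf u hu u' hu').trans (hp _)
  -- Radius at most ρ/2 keeps translates of the half ball inside the ball, and C δ ≤ ε bounds the
  -- displacement of the values.
  let δ : ℝ := min (ρ / 2) (ε / (C + 1))
  have hδ : 0 < δ := by positivity
  have hδε : C * δ ≤ ε := by
    have h1 : δ * (C + 1) ≤ ε := (le_div_iff₀ (by positivity)).1 (min_le_right _ _)
    nlinarith
  let φ : ContDiffBump (0 : E) := ⟨δ / 2, δ, by positivity, by linarith⟩
  let F : E → ℝ := φ.normed m ⋆[ContinuousLinearMap.lsmul ℝ ℝ, m] f'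
  have hFs : ContDiff ℝ ∞ F :=
    φ.hasCompactSupport_normed.contDiff_convolution_left _ φ.contDiff_normed
      hf'L.continuous.locallyIntegrable
  have hint : ∀ u, Integrable (fun t => φ.normed m t * f' (u - t)) m := fun u =>
    (φ.continuous_normed.mul (hf'L.continuous.comp (by fun_prop))).integrable_of_hasCompactSupport
      φ.hasCompactSupport_normed.mul_right
  have hFlip : ∀ u ∈ Metric.ball c (ρ / 2), ∀ u' ∈ Metric.ball c (ρ / 2),
      |F u - F u'| ≤ p (u - u') := fun u hu u' hu' => by
    have e : F u - F u' = ∫ t, φ.normed m t * (f' (u - t) - f' (u' - t)) ∂m := by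
      simp only [F, convolution, ContinuousLinearMap.lsmul_apply, smul_eq_mul]
      rw [← integral_sub (hint u) (hint u')]
      simp only [mul_sub]
    rw [e, ← Real.norm_eq_abs]
    refine (norm_integral_le_of_norm_le (g := fun t => φ.normed m t * p (u - u'))
      (φ.integrable_normed.mul_const _) (Eventually.of_forall fun t => ?_)).trans_eq ?_
    · rw [norm_mul, Real.norm_of_nonneg (φ.nonneg_normed t)]
      by_cases ht : t ∈ Metric.ball (0 : E) δ
      · refine mul_le_mul_of_nonneg_left ?_ (φ.nonneg_normed t)
        have hmem : ∀ v ∈ Metric.ball c (ρ / 2), v - t ∈ Metric.ball c ρ := fun v hv => by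
          rw [Metric.mem_ball, dist_eq_norm] at hv ⊢
          rw [mem_ball_zero_iff] at ht
          have : δ ≤ ρ / 2 := min_le_left _ _
          calc ‖v - t - c‖ = ‖(v - c) - t‖ := by congr 1; abel
            _ ≤ ‖v - c‖ + ‖t‖ := norm_sub_le _ _
            _ < ρ := by linarith
        rw [← hf' (hmem u hu), ← hf' (hmem u' hu')]
        simpa using hf _ (hmem u hu) _ (hmem u' hu')
      · have : φ.normed m t = 0 := by
          rw [← Function.notMem_support, φ.support_normed_eq]
          exact ht
        simp [this]
    · rw [integral_mul_const, φ.integral_normed, one_mul]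
  refine ⟨F, hFs, fun u hu => ⟨?_, fun w => ?_⟩⟩
  · rw [hf' (Metric.ball_subset_ball (by linarith) hu), ← Real.dist_eq]
    refine φ.dist_normed_convolution_le hf'L.continuous.aestronglyMeasurable fun t ht => ?_
    refine (hf'L.dist_le_mul t u).trans ((mul_le_mul_of_nonneg_left ?_ C.2).trans hδε)
    exact (Metric.mem_ball.1 ht).le
  · refine abs_fderiv_le_of_seminorm p (hFs.differentiable (by simp) u) ?_ w
    filter_upwards [Metric.isOpen_ball.mem_nhds hu] with u' hu'
    exact hFlip u' hu' u hu

end Mollification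

/-! ### Smooth approximation of Lipschitz functions in a chart. -/

section LocalApproximation

variable {n : ℕ} {M : Type*} [MetricSpace M] [ChartedSpace (EuclideanSpace ℝ (Fin n)) M]
  [IsManifold (𝓡 n) ∞ M]
  [RiemannianBundle (fun x : M => TangentSpace (𝓡 n) x)]
  [IsContMDiffRiemannianBundle (𝓡 n) ∞ (EuclideanSpace ℝ (Fin n))
      (fun x : M => TangentSpace (𝓡 n) x)]

omit [IsManifold (𝓡 n) ∞ M] in
lemma isContinuousRiemannianBundle_tangentSpace [IsManifold (𝓡 n) 1 M]
    [h : IsContMDiffRiemannianBundle (𝓡 n) ∞ (EuclideanSpace ℝ (Fin n))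
      (fun x : M => TangentSpace (𝓡 n) x)] :
    IsContinuousRiemannianBundle (EuclideanSpace ℝ (Fin n))
      (fun x : M => TangentSpace (𝓡 n) x) := by
  obtain ⟨g, hg, hg'⟩ := h.exists_contMDiff
  exact ⟨g, hg.continuous, hg'⟩

/-- The norm of the tangent space at `x`, read in the chart at `x`. -/
noncomputable def chartSeminorm (n : ℕ) {M : Type*} [MetricSpace M] [ChartedSpace (EuclideanSpace ℝ (Fin n)) M]
    [IsManifold (𝓡 n) ∞ M] [RiemannianBundle (fun x : M => TangentSpace (𝓡 n) x)] (x : M) :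
    Seminorm ℝ (EuclideanSpace ℝ (Fin n)) :=
  (normSeminorm ℝ (TangentSpace (𝓡 n) x)).comp
    ((trivializationAt (EuclideanSpace ℝ (Fin n)) (TangentSpace (𝓡 n)) x).symmL ℝ x).toLinearMap

omit [IsManifold (𝓡 n) ∞ M]
  [IsContMDiffRiemannianBundle (𝓡 n) ∞ (EuclideanSpace ℝ (Fin n))
      (fun x : M => TangentSpace (𝓡 n) x)] in
-- All tangent spaces are the same model space, but the norm depends on the base point; this allows
-- the base point ψ⁻¹(ψ y) to be replaced by y.
lemma norm_tangentSpace_congr {y z : M} (h : y = z) (e : EuclideanSpace ℝ (Fin n)) :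
    ‖(id e : TangentSpace (𝓡 n) y)‖ = ‖(id e : TangentSpace (𝓡 n) z)‖ := by
  subst h; rfl

/-- By continuity of the metric, the norms near x, read in the chart, are comparable to the one at x
up to a factor r > 1. This half bounds lengths of curves drawn in the chart;
`eventually_chartSeminorm_le` is the converse half and bounds gradients. -/
lemma eventually_norm_symm_le (x : M) {r : ℝ} (hr : 1 < r) :
    ∀ᶠ y in 𝓝 x, ∀ w : EuclideanSpace ℝ (Fin n),
      ‖mfderiv (𝓡 n) (𝓡 n) (extChartAt (𝓡 n) x).symm (extChartAt (𝓡 n) x y) w‖ ≤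
        r * chartSeminorm n x w := by
  have := isContinuousRiemannianBundle_tangentSpace (n := n) (M := M)
  filter_upwards [eventually_norm_symmL_trivializationAt_comp_self_lt (EuclideanSpace ℝ (Fin n))
    (fun x : M => TangentSpace (𝓡 n) x) x hr, chart_source_mem_nhds (EuclideanSpace ℝ (Fin n)) x] with y hy hys w
  have hx := mem_chart_source (EuclideanSpace ℝ (Fin n)) x
  have h1 := ContinuousLinearMap.le_of_opNorm_le _ hy.le
    ((trivializationAt (EuclideanSpace ℝ (Fin n)) (TangentSpace (𝓡 n)) x).symmL ℝ x w)
  rw [ContinuousLinearMap.comp_apply, Trivialization.continuousLinearMapAt_symmL _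
    (FiberBundle.mem_baseSet_trivializationAt' x)] at h1
  have e : (id (mfderiv (𝓡 n) (𝓡 n) (extChartAt (𝓡 n) x).symm (extChartAt (𝓡 n) x y) w) :
        EuclideanSpace ℝ (Fin n)) =
      id ((trivializationAt (EuclideanSpace ℝ (Fin n)) (TangentSpace (𝓡 n)) x).symmL ℝ y w) := by
    rw [TangentBundle.symmL_trivializationAt hys, ModelWithCorners.range_eq_univ,
      mfderivWithin_univ]
    rfl
  refine le_trans (le_of_eq ?_) h1
  refine (norm_tangentSpace_congr ((extChartAt (𝓡 n) x).left_inv (by simpa using hys)) _).trans ?_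
  exact congrArg (fun v : EuclideanSpace ℝ (Fin n) => ‖(id v : TangentSpace (𝓡 n) y)‖) e

lemma eventually_chartSeminorm_le (x : M) {r : ℝ} (hr : 1 < r) :
    ∀ᶠ y in 𝓝 x, ∀ v : TangentSpace (𝓡 n) y,
      chartSeminorm n x (mfderiv (𝓡 n) (𝓡 n) (extChartAt (𝓡 n) x) y v) ≤ r * ‖v‖ := by
  have := isContinuousRiemannianBundle_tangentSpace (n := n) (M := M)
  filter_upwards [eventually_norm_symmL_trivializationAt_self_comp_lt (EuclideanSpace ℝ (Fin n))
    (fun x : M => TangentSpace (𝓡 n) x) x hr, chart_source_mem_nhds (EuclideanSpace ℝ (Fin n)) x] with y hy hys v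
  have h1 := ContinuousLinearMap.le_of_opNorm_le _ hy.le v
  rw [TangentBundle.continuousLinearMapAt_trivializationAt hys] at h1
  exact h1

end LocalApproximation

section LocalApproximation

variable {n : ℕ} {M : Type*} [MetricSpace M] [ChartedSpace (EuclideanSpace ℝ (Fin n)) M]
  [IsManifold (𝓡 n) ∞ M]
  [RiemannianBundle (fun x : M => TangentSpace (𝓡 n) x)]

/-- The distance is at most the length of the image of the straight segment from u to u', whose
speed is at most p(u' - u). -/
lemma dist_extChartAt_symm_le [IsRiemannianManifold (𝓡 n) M] {x : M}
    {p : Seminorm ℝ (EuclideanSpace ℝ (Fin n))} {B : Set (EuclideanSpace ℝ (Fin n))}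
    (hBc : Convex ℝ B) (hBt : B ⊆ (extChartAt (𝓡 n) x).target)
    (hB : ∀ u ∈ B, ∀ w : EuclideanSpace ℝ (Fin n),
      ‖mfderiv (𝓡 n) (𝓡 n) (extChartAt (𝓡 n) x).symm u w‖ ≤ p w)
    {u u' : EuclideanSpace ℝ (Fin n)} (hu : u ∈ B) (hu' : u' ∈ B) :
    dist ((extChartAt (𝓡 n) x).symm u) ((extChartAt (𝓡 n) x).symm u') ≤ p (u' - u) := by
  let η := ContinuousAffineMap.lineMap (R := ℝ) u u'
  have hη : Set.Icc 0 1 ⊆ η ⁻¹' B := by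
    simp only [← Set.image_subset_iff, ContinuousAffineMap.coe_lineMap_eq,
      ← segment_eq_image_lineMap, η]
    exact hBc.segment_subset hu hu'
  have η_smooth : ContMDiffOn 𝓘(ℝ, ℝ) (𝓡 n) 1 η (Set.Icc 0 1) := by
    apply ContMDiff.contMDiffOn
    rw [contMDiff_iff_contDiff]
    exact ContinuousAffineMap.contDiff _
  have key : riemannianEDist (𝓡 n) ((extChartAt (𝓡 n) x).symm u) ((extChartAt (𝓡 n) x).symm u') ≤
      pathELength (𝓡 n) ((extChartAt (𝓡 n) x).symm ∘ η) 0 1 := by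
    apply riemannianEDist_le_pathELength _ _ _ zero_le_one
    · exact (contMDiffOn_extChartAt_symm (n := 1) x).comp η_smooth
        (hη.trans (Set.preimage_mono hBt))
    · simp [η, ContinuousAffineMap.coe_lineMap_eq]
    · simp [η, ContinuousAffineMap.coe_lineMap_eq]
  rw [← IsRiemannianManifold.out (I := 𝓡 n), edist_dist] at key
  rw [← ENNReal.ofReal_le_ofReal_iff (apply_nonneg p _)]
  refine key.trans ?_
  rw [pathELength_eq_lintegral_mfderivWithin_Icc]
  calc _ ≤ ∫⁻ t in Set.Icc (0 : ℝ) 1, ENNReal.ofReal (p (u' - u)) := by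
        refine setLIntegral_mono' measurableSet_Icc fun t ht => ?_
        have hder : mfderivWithin 𝓘(ℝ, ℝ) (𝓡 n) ((extChartAt (𝓡 n) x).symm ∘ η) (Set.Icc 0 1) t =
            (mfderiv (𝓡 n) (𝓡 n) (extChartAt (𝓡 n) x).symm (η t)).comp
              (mfderivWithin 𝓘(ℝ, ℝ) (𝓡 n) η (Set.Icc 0 1) t) := by
          apply mfderiv_comp_mfderivWithin
          · exact ((contMDiffOn_extChartAt_symm (I := 𝓡 n) (n := 1) x).contMDiffAt
              ((isOpen_extChartAt_target x).mem_nhds (hBt (hη ht)))).mdifferentiableAt (by simp)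
          · exact η_smooth.mdifferentiableOn one_ne_zero t ht
          · rw [uniqueMDiffWithinAt_iff_uniqueDiffWithinAt]
            exact uniqueDiffOn_Icc zero_lt_one t ht
        have hη' : fderivWithin ℝ η (Set.Icc 0 1) t (1 : ℝ) = u' - u := by
          have hd : HasDerivWithinAt η (u' - u) (Set.Icc 0 1) t := by
            rw [ContinuousAffineMap.coe_lineMap_eq]
            exact AffineMap.hasDerivWithinAt_lineMap
          rw [fderivWithin_derivWithin]
          exact hd.derivWithin (uniqueDiffOn_Icc zero_lt_one t ht)
        rw [← mfderivWithin_eq_fderivWithin] at hη'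
        rw [hder, ← ofReal_norm]
        refine ENNReal.ofReal_le_ofReal ?_
        refine (hB (η t) (hη ht) _).trans (le_of_eq ?_)
        exact congrArg p hη'
    _ = ENNReal.ofReal (p (u' - u)) := by simp

variable [IsContMDiffRiemannianBundle (𝓡 n) ∞ (EuclideanSpace ℝ (Fin n))
      (fun x : M => TangentSpace (𝓡 n) x)]

/-- Near any point, `1`-Lipschitz functions have smooth uniform approximations whose gradient is
almost bounded by `1`, on a neighbourhood which does not depend on the precision. -/
lemma exists_local_smooth_approx [IsRiemannianManifold (𝓡 n) M] (x : M) {r : ℝ} (hr : 1 < r) :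
    ∃ U : Set M, IsOpen U ∧ x ∈ U ∧ ∀ g : M → ℝ, LipschitzWith 1 g → ∀ ε : ℝ, 0 < ε →
      ∃ h : M → ℝ, ContMDiffOn (𝓡 n) 𝓘(ℝ, ℝ) ∞ h U ∧
        ∀ y ∈ U, |h y - g y| ≤ ε ∧ gradNorm n h y ≤ ENNReal.ofReal (r * r) := by
  have hr0 : 0 < r := by linarith
  let ψ := extChartAt (𝓡 n) x
  -- One factor r is spent here, so that g read in the chart is 1-Lipschitz for `p`; the other is
  -- spent in turning the bound on dF back into a bound on M. Hence the constant r * r.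
  let p : Seminorm ℝ (EuclideanSpace ℝ (Fin n)) := r.toNNReal • chartSeminorm n x
  have hp : ∀ w, p w = r * chartSeminorm n x w := fun w => by
    simp [p, NNReal.smul_def, hr0.le]
  obtain ⟨ρ, hρ, hball⟩ : ∃ ρ > 0, Metric.ball (ψ x) ρ ⊆ ψ.target ∩
      {u | ∀ w : EuclideanSpace ℝ (Fin n), ‖mfderiv (𝓡 n) (𝓡 n) ψ.symm u w‖ ≤ p w} := by
    refine Metric.mem_nhds_iff.1 (inter_mem (extChartAt_target_mem_nhds x) ?_)
    have hc : Tendsto ψ.symm (𝓝 (ψ x)) (𝓝 x) := by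
      have := continuousAt_extChartAt_symm (I := 𝓡 n) x
      rwa [ContinuousAt, extChartAt_to_inv] at this
    filter_upwards [hc.eventually (eventually_norm_symm_le (n := n) x hr),
      extChartAt_target_mem_nhds x] with u hu hut w
    have := hu w
    rw [ψ.right_inv hut] at this
    exact this.trans_eq (hp w).symm
  obtain ⟨C, hC⟩ : ∃ C : ℝ≥0, ∀ w, p w ≤ C * ‖w‖ := by
    let S := (trivializationAt (EuclideanSpace ℝ (Fin n)) (TangentSpace (𝓡 n)) x).symmL ℝ x
    refine ⟨r.toNNReal * ‖S‖₊, fun w => ?_⟩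
    rw [hp, NNReal.coe_mul, Real.coe_toNNReal r hr0.le, mul_assoc]
    exact mul_le_mul_of_nonneg_left (S.le_opNorm w) hr0.le
  obtain ⟨U, hU, hUo, hxU⟩ : ∃ U ⊆ {y | y ∈ ψ.source ∧ ψ y ∈ Metric.ball (ψ x) (ρ / 2) ∧
      ∀ v : TangentSpace (𝓡 n) y, chartSeminorm n x (mfderiv (𝓡 n) (𝓡 n) ψ y v) ≤ r * ‖v‖},
      IsOpen U ∧ x ∈ U := by
    refine mem_nhds_iff.1 ?_
    filter_upwards [extChartAt_source_mem_nhds (I := 𝓡 n) x,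
      (continuousAt_extChartAt (I := 𝓡 n) x).preimage_mem_nhds
        (Metric.ball_mem_nhds (ψ x) (half_pos hρ)), eventually_chartSeminorm_le (n := n) x hr]
      with y h1 h2 h3 using ⟨h1, h2, h3⟩
  refine ⟨U, hUo, hxU, fun g hg ε hε => ?_⟩
  obtain ⟨F, hF, hFε⟩ := exists_contDiff_approx_of_seminorm_lipschitz p hC
    (f := fun u => g (ψ.symm u)) hρ (fun u hu u' hu' => by
      rw [← Real.dist_eq, map_sub_rev p]
      refine (hg.dist_le_mul _ _).trans ?_
      rw [NNReal.coe_one, one_mul]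
      exact dist_extChartAt_symm_le (convex_ball _ _) (fun v hv => (hball hv).1)
        (fun v hv => (hball hv).2) hu hu') hε
  have hψ : ContMDiffOn (𝓡 n) (𝓡 n) ∞ ψ U := contMDiffOn_extChartAt.mono fun y hy => by
    simpa [ψ] using (hU hy).1
  refine ⟨F ∘ ψ, hF.contMDiff.comp_contMDiffOn hψ, fun y hy => ?_⟩
  obtain ⟨hys, hyB, hyv⟩ := hU hy
  obtain ⟨h1, h2⟩ := hFε _ hyB
  rw [ψ.left_inv hys] at h1
  refine ⟨h1, ?_⟩
  rw [gradNorm, ← ofReal_norm]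
  refine ENNReal.ofReal_le_ofReal (ContinuousLinearMap.opNorm_le_bound _ (by positivity) fun v => ?_)
  have hder : mvfderiv (𝓡 n) (F ∘ ψ) y v =
      fderiv ℝ F (ψ y) (mfderiv (𝓡 n) (𝓡 n) ψ y v) := by
    have h3 : MDifferentiableAt (𝓡 n) (𝓡 n) ψ y :=
      mdifferentiableAt_extChartAt (by simpa [ψ] using hys)
    have h4 : MDifferentiableAt (𝓡 n) 𝓘(ℝ, ℝ) F (ψ y) :=
      (hF.differentiable (by simp) _).mdifferentiableAt
    rw [mvfderiv_comp_apply y h4 h3, mvfderiv, mfderiv_eq_fderiv]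
    rfl
  rw [hder, Real.norm_eq_abs]
  refine (h2 _).trans ?_
  refine (hp _).trans_le ?_
  rw [mul_assoc]
  exact mul_le_mul_of_nonneg_left (hyv v) hr0.le

end LocalApproximation

/-! ### Gluing the local approximations. -/

section GlobalApproximation

variable {n : ℕ} {M : Type*} [MetricSpace M] [ChartedSpace (EuclideanSpace ℝ (Fin n)) M]
  [RiemannianBundle (fun x : M => TangentSpace (𝓡 n) x)]

lemma gradNorm_eq_ofReal (f : M → ℝ) (x : M) :
    gradNorm n f x = ENNReal.ofReal ‖mvfderiv (𝓡 n) f x‖ := (ofReal_norm _).symm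

lemma gradNorm_le_ofReal_iff {f : M → ℝ} {x : M} {c : ℝ} (hc : 0 ≤ c) :
    gradNorm n f x ≤ ENNReal.ofReal c ↔ ‖mvfderiv (𝓡 n) f x‖ ≤ c := by
  rw [gradNorm_eq_ofReal, ENNReal.ofReal_le_ofReal_iff hc]

omit [RiemannianBundle (fun x : M => TangentSpace (𝓡 n) x)] in
lemma mvfderiv_congr_of_eventuallyEq {f g : M → ℝ} {x : M} (h : f =ᶠ[𝓝 x] g) :
    mvfderiv (𝓡 n) f x = mvfderiv (𝓡 n) g x := by
  ext v
  simp only [mvfderiv]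
  exact congrArg (fun L : TangentSpace (𝓡 n) x →L[ℝ] ℝ => L v) h.mfderiv_eq

omit [RiemannianBundle (fun x : M => TangentSpace (𝓡 n) x)] in
lemma mdifferentiableAt_sum_mul {ι : Type*} (T : Finset ι) {a b : ι → M → ℝ} {x : M}
    (ha : ∀ i ∈ T, MDifferentiableAt (𝓡 n) 𝓘(ℝ, ℝ) (a i) x)
    (hb : ∀ i ∈ T, MDifferentiableAt (𝓡 n) 𝓘(ℝ, ℝ) (b i) x) :
    MDifferentiableAt (𝓡 n) 𝓘(ℝ, ℝ) (fun y => ∑ i ∈ T, a i y * b i y) x ∧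
    mvfderiv (𝓡 n) (fun y => ∑ i ∈ T, a i y * b i y) x =
      ∑ i ∈ T, (a i x • mvfderiv (𝓡 n) (b i) x + b i x • mvfderiv (𝓡 n) (a i) x) := by
  classical
  induction T using Finset.induction_on with
  | empty => simpa using ⟨mdifferentiableAt_const, mvfderiv_const (I := 𝓡 n) (0 : ℝ) (x := x)⟩
  | insert i T hi ih =>
    obtain ⟨h1, h2⟩ := ih (fun j hj => ha j (Finset.mem_insert_of_mem hj))
      (fun j hj => hb j (Finset.mem_insert_of_mem hj))
    have hai := ha i (Finset.mem_insert_self i T)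
    have hbi := hb i (Finset.mem_insert_self i T)
    simp only [Finset.sum_insert hi]
    have hab : MDifferentiableAt (𝓡 n) 𝓘(ℝ, ℝ) (a i * b i) x := hai.mul hbi
    refine ⟨hab.add h1, ?_⟩
    have := mvfderiv_add hab h1
    rw [mvfderiv_mul hai hbi, h2] at this
    exact this

variable [IsManifold (𝓡 n) ∞ M]
  [IsContMDiffRiemannianBundle (𝓡 n) ∞ (EuclideanSpace ℝ (Fin n))
      (fun x : M => TangentSpace (𝓡 n) x)]

lemma exists_eventually_norm_mvfderiv_le {f : M → ℝ} (hf : ContMDiff (𝓡 n) 𝓘(ℝ, ℝ) ∞ f) (x : M) :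
    ∃ C : ℝ, ∀ᶠ y in 𝓝 x, ‖mvfderiv (𝓡 n) f y‖ ≤ C := by
  have := isContinuousRiemannianBundle_tangentSpace (n := n) (M := M)
  obtain ⟨C, hC0, hC⟩ := eventually_norm_trivializationAt_lt (EuclideanSpace ℝ (Fin n))
    (fun x : M => TangentSpace (𝓡 n) x) x
  let ψ := extChartAt (𝓡 n) x
  have hF : ContDiffOn ℝ 1 (f ∘ ψ.symm) ψ.target := by
    rw [← contMDiffOn_iff_contDiffOn]
    exact (hf.of_le (by simp)).comp_contMDiffOn (contMDiffOn_extChartAt_symm x)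
  have ht : IsOpen ψ.target := isOpen_extChartAt_target x
  have hcont : ContinuousAt (fun y => fderiv ℝ (f ∘ ψ.symm) (ψ y)) x :=
    ContinuousAt.comp (f := ψ) ((hF.continuousOn_fderiv_of_isOpen ht le_rfl).continuousAt
      (ht.mem_nhds (mem_extChartAt_target x))) (continuousAt_extChartAt x)
  refine ⟨(‖fderiv ℝ (f ∘ ψ.symm) (ψ x)‖ + 1) * C, ?_⟩
  filter_upwards [hC, chart_source_mem_nhds (EuclideanSpace ℝ (Fin n)) x,
    hcont.norm.eventually (gt_mem_nhds (lt_add_one _))] with y h1 h2 h3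
  have hys : y ∈ ψ.source := by simpa [ψ] using h2
  have hd1 : MDifferentiableAt (𝓡 n) (𝓡 n) ψ y := mdifferentiableAt_extChartAt h2
  have hd2 : MDifferentiableAt (𝓡 n) 𝓘(ℝ, ℝ) (f ∘ ψ.symm) (ψ y) :=
    ((hF.differentiableOn (by simp)).differentiableAt
      (ht.mem_nhds (ψ.map_source hys))).mdifferentiableAt
  have heq : f =ᶠ[𝓝 y] (f ∘ ψ.symm) ∘ ψ := by
    filter_upwards [(isOpen_extChartAt_source (I := 𝓡 n) x).mem_nhds hys] with z hz
    simp only [Function.comp_apply]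
    rw [ψ.left_inv hz]
  refine ContinuousLinearMap.opNorm_le_bound _ (by positivity) fun v => ?_
  have hder : mvfderiv (𝓡 n) f y v = fderiv ℝ (f ∘ ψ.symm) (ψ y)
      ((trivializationAt (EuclideanSpace ℝ (Fin n)) (TangentSpace (𝓡 n)) x).continuousLinearMapAt
        ℝ y v) := by
    rw [mvfderiv_congr_of_eventuallyEq heq, mvfderiv_comp_apply y hd2 hd1, mvfderiv,
      mfderiv_eq_fderiv, TangentBundle.continuousLinearMapAt_trivializationAt h2]
    rfl
  rw [hder, mul_assoc]
  refine (ContinuousLinearMap.le_opNorm _ _).trans ?_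
  gcongr
  exact ContinuousLinearMap.le_of_opNorm_le _ h1.le v

lemma exists_norm_mvfderiv_le_of_isCompact {f : M → ℝ} (hf : ContMDiff (𝓡 n) 𝓘(ℝ, ℝ) ∞ f)
    {K : Set M} (hK : IsCompact K) : ∃ C : ℝ, ∀ y ∈ K, ‖mvfderiv (𝓡 n) f y‖ ≤ C := by
  refine hK.induction_on (p := fun K => ∃ C : ℝ, ∀ y ∈ K, ‖mvfderiv (𝓡 n) f y‖ ≤ C)
    ⟨0, by simp⟩ ?_ ?_ ?_
  · rintro s t hst ⟨C, hC⟩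
    exact ⟨C, fun y hy => hC y (hst hy)⟩
  · rintro s t ⟨C, hC⟩ ⟨C', hC'⟩
    refine ⟨max C C', ?_⟩
    rintro y (hy | hy)
    · exact (hC y hy).trans (le_max_left _ _)
    · exact (hC' y hy).trans (le_max_right _ _)
  · intro x _
    obtain ⟨C, hC⟩ := exists_eventually_norm_mvfderiv_le hf x
    exact ⟨_, mem_nhdsWithin_of_mem_nhds hC, C, fun y hy => hy⟩

/-- A `1`-Lipschitz function on a Riemannian manifold is a uniform limit of smooth functions whose
gradients are uniformly bounded by numbers arbitrarily close to `1`. -/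
theorem exists_smooth_approx [ProperSpace M] [IsRiemannianManifold (𝓡 n) M] {g : M → ℝ}
    (hg : LipschitzWith 1 g) {ε : ℝ} (hε : 0 < ε) :
    ∃ h : M → ℝ, ContMDiff (𝓡 n) 𝓘(ℝ, ℝ) ∞ h ∧
      ∀ y, |h y - g y| ≤ ε ∧ gradNorm n h y ≤ ENNReal.ofReal (1 + ε) := by
  obtain ⟨r, hr1, hr⟩ : ∃ r : ℝ, 1 < r ∧ r * r ≤ 1 + ε / 2 := by
    refine ⟨√(1 + ε / 2), ?_, (Real.mul_self_sqrt (by positivity)).le⟩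
    rw [Real.lt_sqrt zero_le_one]
    linarith
  choose U hUo hxU hU using fun x : M => exists_local_smooth_approx (n := n) x hr1
  -- The unit balls confine each partition function to a compact set, on which its gradient is
  -- bounded by some C i.
  let W : M → Set M := fun x => U x ∩ Metric.ball x 1
  have hWo : ∀ x, IsOpen (W x) := fun x => (hUo x).inter Metric.isOpen_ball
  obtain ⟨s, hs, hcov⟩ := TopologicalSpace.countable_cover_nhds fun x =>
    (hWo x).mem_nhds ⟨hxU x, Metric.mem_ball_self one_pos⟩
  have : Encodable s := hs.toEncodable
  obtain ⟨ρ, hρ⟩ := SmoothPartitionOfUnity.exists_isSubordinate (𝓡 n) isClosed_univ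
    (fun i : s => W i) (fun i => hWo i) (by rw [← hcov, Set.biUnion_eq_iUnion])
  obtain ⟨δ, hδ, c, hδc, hcε⟩ := posSumOfEncodable (half_pos hε) s
  have hδsum : ∀ T : Finset s, ∑ i ∈ T, δ i ≤ ε / 2 := fun T =>
    (sum_le_hasSum T (fun i _ => (hδ i).le) hδc).trans hcε
  choose C hC using fun i : s => exists_norm_mvfderiv_le_of_isCompact (ρ i).contMDiff
    (isCompact_closedBall (i : M) 1)
  -- This precision makes |h i - g| |∇ρ i| ≤ δ i, and the δ i sum to at most ε/2.
  let η : s → ℝ := fun i => δ i / (1 + |C i|)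
  have hη : ∀ i, 0 < η i := fun i => div_pos (hδ i) (by positivity)
  have hη1 : ∀ i, η i * (1 + |C i|) = δ i := fun i => div_mul_cancel₀ _ (by positivity)
  choose h hhs hh using fun i : s => hU i g hg (η i) (hη i)
  have hhat : ∀ i, ∀ y ∈ tsupport (ρ i), ContMDiffAt (𝓡 n) 𝓘(ℝ, ℝ) ∞ (h i) y := fun i y hy =>
    (hhs i).contMDiffAt ((hUo i).mem_nhds (hρ i hy).1)
  have hsmooth : ContMDiff (𝓡 n) 𝓘(ℝ, ℝ) ∞ fun y => ∑ᶠ i, ρ i y • h i y :=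
    ρ.contMDiff_finsum_smul (n := ⊤) hhat
  refine ⟨_, hsmooth, fun y => ?_⟩
  let T := ρ.fintsupport y
  have hT : ∀ i ∈ T, y ∈ tsupport (ρ i) := fun i hi => (ρ.mem_fintsupport_iff y i).1 hi
  have hsum1 : ∀ z, ρ.finsupport z ⊆ T → ∑ i ∈ T, ρ i z = 1 := fun z hz =>
    ρ.sum_finsupport' z (Set.mem_univ z) hz
  have hdiff : ∀ z, ρ.finsupport z ⊆ T → (∑ᶠ i, ρ i z • h i z) - g y =
      ∑ i ∈ T, ρ i z * (h i z - g y) := fun z hz => by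
    rw [← ρ.sum_finsupport_smul_eq_finsum, Finset.sum_subset hz fun i _ hi => ?_]
    · simp only [mul_sub, Finset.sum_sub_distrib, ← Finset.sum_mul, hsum1 z hz, one_mul,
        smul_eq_mul]
    · have : ρ i z = 0 := by simpa using hi
      simp [this]
  have hyT : ρ.finsupport y ⊆ T := ρ.finsupport_subset_fintsupport y
  have hclose : ∀ i ∈ T, |h i y - g y| ≤ η i := fun i hi => (hh i y (hρ i (hT i hi)).1).1
  have hηδ : ∀ i, η i ≤ δ i := fun i => by
    rw [← hη1 i]
    exact le_mul_of_one_le_right (hη i).le (by linarith [abs_nonneg (C i)])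
  constructor
  · rw [hdiff y hyT]
    calc |∑ i ∈ T, ρ i y * (h i y - g y)| ≤ ∑ i ∈ T, |ρ i y * (h i y - g y)| :=
          Finset.abs_sum_le_sum_abs _ _
      _ ≤ ∑ i ∈ T, δ i := Finset.sum_le_sum fun i hi => by
          rw [abs_mul, abs_of_nonneg (ρ.nonneg i y)]
          exact (mul_le_of_le_one_left (abs_nonneg _) (ρ.le_one i y)).trans
            ((hclose i hi).trans (hηδ i))
      _ ≤ ε := (hδsum T).trans (by linarith)
  · rw [gradNorm_le_ofReal_iff (by positivity)]
    have hdh : ∀ i ∈ T, MDifferentiableAt (𝓡 n) 𝓘(ℝ, ℝ) (h i) y := fun i hi =>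
      (hhat i y (hT i hi)).mdifferentiableAt (by simp)
    have hdc : MDifferentiableAt (𝓡 n) 𝓘(ℝ, ℝ) (fun _ : M => g y) y := mdifferentiableAt_const
    have hdρ : ∀ i ∈ T, MDifferentiableAt (𝓡 n) 𝓘(ℝ, ℝ) (ρ i) y := fun i _ =>
      (ρ i).contMDiff.contMDiffAt.mdifferentiableAt (by simp)
    -- Since the ρ i sum to 1, the constant g(y) may be subtracted from each h i before
    -- differentiating. The terms in ∇ρ i thus carry the small factors h i - g(y).
    have hder : mvfderiv (𝓡 n) (fun z => ∑ᶠ i, ρ i z • h i z) y =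
        ∑ i ∈ T, (ρ i y • mvfderiv (𝓡 n) (h i) y +
          (h i y - g y) • mvfderiv (𝓡 n) (ρ i) y) := by
      have e1 := mvfderiv_sub (hsmooth.mdifferentiableAt (by simp) (x := y)) hdc
      rw [mvfderiv_const, sub_zero] at e1
      rw [← e1]
      have e2 : (fun z => ∑ᶠ i, ρ i z • h i z) - (fun _ => g y) =ᶠ[𝓝 y]
          fun z => ∑ i ∈ T, ρ i z * (h i - fun _ : M => g y : M → ℝ) z := by
        filter_upwards [ρ.eventually_finsupport_subset y] with z hz
        exact hdiff z hz
      rw [mvfderiv_congr_of_eventuallyEq e2,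
        (mdifferentiableAt_sum_mul T hdρ fun i hi => (hdh i hi).sub hdc).2]
      refine Finset.sum_congr rfl fun i hi => ?_
      rw [mvfderiv_sub (hdh i hi) hdc, mvfderiv_const, sub_zero]
      rfl
    rw [hder]
    refine ContinuousLinearMap.opNorm_le_bound _ (by positivity) fun v => ?_
    have hterm : ∀ i ∈ T, ‖ρ i y * mvfderiv (𝓡 n) (h i) y v +
        (h i y - g y) * mvfderiv (𝓡 n) (ρ i) y v‖ ≤
          (ρ i y * (1 + ε / 2) + δ i) * ‖v‖ := fun i hi => by
      rw [add_mul]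
      refine (norm_add_le _ _).trans (add_le_add ?_ ?_)
      · rw [norm_mul, Real.norm_of_nonneg (ρ.nonneg i y), mul_assoc]
        refine mul_le_mul_of_nonneg_left ?_ (ρ.nonneg i y)
        exact ContinuousLinearMap.le_of_opNorm_le _ (((gradNorm_le_ofReal_iff (by positivity)).1
          (hh i y (hρ i (hT i hi)).1).2).trans hr) v
      · rw [norm_mul, Real.norm_eq_abs, ← hη1 i, mul_assoc]
        refine mul_le_mul (hclose i hi) ?_ (norm_nonneg _) (hη i).le
        refine ContinuousLinearMap.le_of_opNorm_le _ ?_ v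
        have := hC i y (Metric.ball_subset_closedBall (hρ i (hT i hi)).2)
        linarith [le_abs_self (C i)]
    rw [_root_.sum_apply]
    refine (norm_sum_le_of_le T hterm).trans ?_
    rw [← Finset.sum_mul, Finset.sum_add_distrib, ← Finset.sum_mul, hsum1 y hyT]
    refine mul_le_mul_of_nonneg_right ?_ (norm_nonneg _)
    linarith [hδsum T]

end GlobalApproximation

/-! ### Cutoffs, exponentials and their Fisher information. -/

section TestFunctions

variable {n : ℕ} {M : Type*} [MetricSpace M] [ChartedSpace (EuclideanSpace ℝ (Fin n)) M]
  [RiemannianBundle (fun x : M => TangentSpace (𝓡 n) x)]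

lemma norm_mvfderiv_comp_le {h : M → ℝ} {θ : ℝ → ℝ} {x : M} (hθ : DifferentiableAt ℝ θ (h x))
    (hh : MDifferentiableAt (𝓡 n) 𝓘(ℝ, ℝ) h x) :
    ‖mvfderiv (𝓡 n) (θ ∘ h) x‖ ≤ |deriv θ (h x)| * ‖mvfderiv (𝓡 n) h x‖ := by
  refine ContinuousLinearMap.opNorm_le_bound _ (by positivity) fun v => ?_
  have : mvfderiv (𝓡 n) (θ ∘ h) x v = mvfderiv (𝓡 n) h x v * deriv θ (h x) := by
    rw [mvfderiv_comp_apply x hθ.mdifferentiableAt hh, mvfderiv, mfderiv_eq_fderiv]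
    exact fderiv_eq_smul_deriv (f := θ) (x := h x) (mvfderiv (𝓡 n) h x v)
  rw [this, norm_mul, Real.norm_eq_abs (deriv _ _), mul_comm, mul_assoc]
  exact mul_le_mul_of_nonneg_left (ContinuousLinearMap.le_opNorm _ v) (abs_nonneg _)

/-- The gradient of a product of a cutoff with an exponential. -/
lemma gradNorm_mul_exp_le {χ h : M → ℝ} {x : M} (hχ : MDifferentiableAt (𝓡 n) 𝓘(ℝ, ℝ) χ x)
    (hh : MDifferentiableAt (𝓡 n) 𝓘(ℝ, ℝ) h x) (h0 : 0 ≤ χ x) (h1 : χ x ≤ 1) {a b s c : ℝ}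
    (ha : 0 ≤ a) (hb : 0 ≤ b) (hs : 0 ≤ s)
    (hχa : gradNorm n χ x ≤ ENNReal.ofReal a) (hhb : gradNorm n h x ≤ ENNReal.ofReal b) :
    gradNorm n (fun y => χ y * Real.exp (s * h y + c)) x ≤
      ENNReal.ofReal ((a + s * b) * Real.exp (s * h x + c)) := by
  rw [gradNorm_le_ofReal_iff (by positivity)] at hχa hhb ⊢
  let θ : ℝ → ℝ := fun t => Real.exp (s * t + c)
  have hθ : ∀ t, HasDerivAt θ (Real.exp (s * t + c) * s) t := fun t => by
    have := (((hasDerivAt_id t).const_mul s).add_const c).exp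
    simpa using this
  have hθh := norm_mvfderiv_comp_le (θ := θ) (hθ (h x)).differentiableAt hh
  rw [(hθ (h x)).deriv, abs_mul, abs_of_nonneg hs, Real.abs_exp] at hθh
  have hd : MDifferentiableAt (𝓡 n) 𝓘(ℝ, ℝ) (θ ∘ h) x :=
    (hθ (h x)).differentiableAt.mdifferentiableAt.comp x hh
  have hmul := mvfderiv_mul hχ hd
  refine ContinuousLinearMap.opNorm_le_bound _ (by positivity) fun v => ?_
  have hv : mvfderiv (𝓡 n) (fun y => χ y * Real.exp (s * h y + c)) x v =
      χ x * mvfderiv (𝓡 n) (θ ∘ h) x v + Real.exp (s * h x + c) * mvfderiv (𝓡 n) χ x v :=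
    congrArg (fun L : TangentSpace (𝓡 n) x →L[ℝ] ℝ => L v) hmul
  rw [hv]
  refine (norm_add_le _ _).trans ?_
  rw [norm_mul, norm_mul, Real.norm_of_nonneg h0, Real.norm_of_nonneg (Real.exp_pos _).le]
  have e1 : ‖mvfderiv (𝓡 n) (θ ∘ h) x v‖ ≤ Real.exp (s * h x + c) * s * b * ‖v‖ :=
    ContinuousLinearMap.le_of_opNorm_le _
      (hθh.trans (mul_le_mul_of_nonneg_left hhb (by positivity))) v
  have e2 : ‖mvfderiv (𝓡 n) χ x v‖ ≤ a * ‖v‖ := ContinuousLinearMap.le_of_opNorm_le _ hχa v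
  have e3 : χ x * ‖mvfderiv (𝓡 n) (θ ∘ h) x v‖ ≤ ‖mvfderiv (𝓡 n) (θ ∘ h) x v‖ :=
    mul_le_of_le_one_left (norm_nonneg _) h1
  have e4 := mul_le_mul_of_nonneg_left e2 (Real.exp_pos (s * h x + c)).le
  calc _ ≤ Real.exp (s * h x + c) * s * b * ‖v‖ + Real.exp (s * h x + c) * (a * ‖v‖) :=
        add_le_add (e3.trans e1) e4
    _ = _ := by ring

variable [MeasurableSpace M] [BorelSpace M]

/-- The Fisher information of `φ² μ` is at most the energy of `φ`, for a nonnegative test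
function `φ`. -/
lemma fisherInformation_le_preEnergy {μ : Measure M} [IsProbabilityMeasure μ] {φ : M → ℝ}
    (hφ : ContMDiff (𝓡 n) 𝓘(ℝ, ℝ) ∞ φ) (hc : HasCompactSupport φ) (h0 : ∀ x, 0 ≤ φ x) :
    fisherInformation n (μ.withDensity fun x => ENNReal.ofReal (φ x ^ 2)) μ ≤
      preEnergy n μ φ := by
  set ν := μ.withDensity fun x => ENNReal.ofReal (φ x ^ 2)
  have hmeas : Measurable fun x => ENNReal.ofReal (φ x ^ 2) :=
    (hφ.continuous.pow 2).measurable.ennreal_ofReal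
  have hae : (fun x => √(ν.rnDeriv μ x).toReal) =ᵐ[μ] φ := by
    filter_upwards [Measure.rnDeriv_withDensity μ hmeas] with x hx
    rw [hx, ENNReal.toReal_ofReal (sq_nonneg _), Real.sqrt_sq (h0 x)]
  -- The constant sequence φ approximates; the form is an infimum over approximating sequences, so
  -- its energy is an upper bound.
  have happ : IsApproximating n μ (fun x => √(ν.rnDeriv μ x).toReal) fun _ => φ :=
    { smooth := fun _ => hφ
      compact := fun _ => hc
      tendsto_L2 := by
        have : (fun x => φ x - √(ν.rnDeriv μ x).toReal) =ᵐ[μ] 0 := by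
          filter_upwards [hae] with x hx
          simp [hx]
        simp [eLpNorm_congr_ae this]
      cauchy := by
        have : preEnergy n μ (fun x => φ x - φ x) = 0 := by
          have h1 : ∀ x : M, gradNorm n (fun _ : M => (0 : ℝ)) x = 0 := fun x => by
            rw [gradNorm_eq_ofReal, mvfderiv_const, ContinuousLinearMap.opNorm_zero, ENNReal.ofReal_zero]
          simp [preEnergy, h1]
        simp only [this, tendsto_const_nhds] }
  have hmem : MemLp (fun x => √(ν.rnDeriv μ x).toReal) 2 μ :=
    (memLp_congr_ae hae).2 (hφ.continuous.memLp_of_hasCompactSupport hc)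
  rw [fisherInformation, if_pos ⟨withDensity_absolutelyContinuous _ _, hmem, _, happ⟩]
  exact sInf_le ⟨_, happ, tendsto_const_nhds⟩

variable [IsManifold (𝓡 n) ∞ M]
  [IsContMDiffRiemannianBundle (𝓡 n) ∞ (EuclideanSpace ℝ (Fin n))
      (fun x : M => TangentSpace (𝓡 n) x)]

omit [MeasurableSpace M] [BorelSpace M] in
/-- Smooth compactly supported cutoffs with uniformly small gradients. -/
lemma exists_smooth_cutoff [ProperSpace M] [IsRiemannianManifold (𝓡 n) M] (x₀ : M) :
    ∃ C : ℝ, 0 ≤ C ∧ ∀ k : ℕ, ∃ χ : M → ℝ, ContMDiff (𝓡 n) 𝓘(ℝ, ℝ) ∞ χ ∧ HasCompactSupport χ ∧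
      (∀ x, 0 ≤ χ x ∧ χ x ≤ 1 ∧ gradNorm n χ x ≤ ENNReal.ofReal (C / (k + 1))) ∧
      ∀ x, dist x x₀ ≤ k → χ x = 1 := by
  obtain ⟨h, hh, hhd⟩ := exists_smooth_approx (n := n) (LipschitzWith.dist_left x₀) one_pos
  let b : ContDiffBump (0 : ℝ) := ⟨1, 2, one_pos, one_lt_two⟩
  have hb : ContDiff ℝ ∞ b := b.contDiff
  obtain ⟨L, hL⟩ := (hb.of_le (m := 1) (by simp)).lipschitzWith_of_hasCompactSupport
    b.hasCompactSupport (by simp)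
  refine ⟨L * 2, by positivity, fun k => ?_⟩
  -- The scale k + 1 absorbs the error 1 between h and the distance: on the ball of radius k, |h| ≤
  -- k + 1. As |∇h| ≤ 2, the gradient of the cutoff is at most 2L/(k + 1).
  let θ : ℝ → ℝ := fun t => b ((k + 1 : ℝ)⁻¹ * t)
  have hθ : ContDiff ℝ ∞ θ := hb.comp (contDiff_const.mul contDiff_id)
  have hk : (0 : ℝ) < k + 1 := by positivity
  have habs : ∀ t : ℝ, dist ((k + 1 : ℝ)⁻¹ * t) 0 = |t| / (k + 1) := fun t => by
    rw [dist_zero_right, Real.norm_eq_abs, abs_mul, abs_of_pos (inv_pos.2 hk), div_eq_inv_mul]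
  have hθd : ∀ t, |deriv θ t| ≤ L / (k + 1) := fun t => by
    have hlip : LipschitzWith (L * (k + 1 : ℝ≥0)⁻¹) θ := by
      refine hL.comp (LipschitzWith.of_dist_le_mul fun s t => ?_)
      simp [Real.dist_eq, ← mul_sub, abs_mul, abs_of_pos hk]
    have := norm_deriv_le_of_lipschitz (x₀ := t) hlip
    simpa [div_eq_mul_inv] using this
  refine ⟨θ ∘ h, hθ.contMDiff.comp hh, ?_, fun x => ⟨b.nonneg, b.le_one, ?_⟩, fun x hx => ?_⟩
  · refine HasCompactSupport.of_support_subset_isCompact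
      (isCompact_closedBall x₀ (2 * (k + 1) + 1)) fun x hx => ?_
    rw [Metric.mem_closedBall]
    by_contra! hlt
    refine hx (b.zero_of_le_dist ?_)
    rw [habs, le_div_iff₀ hk]
    have := abs_le.1 (hhd x).1
    exact (by linarith : 2 * ((k : ℝ) + 1) ≤ h x).trans (le_abs_self _)
  · rw [gradNorm_le_ofReal_iff (by positivity)]
    refine (norm_mvfderiv_comp_le (hθ.differentiable (by simp) _)
      (hh.mdifferentiableAt (by simp))).trans ?_
    have := (gradNorm_le_ofReal_iff (by norm_num)).1 (hhd x).2
    refine (mul_le_mul (hθd _) this (ContinuousLinearMap.opNorm_nonneg _)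
      (by positivity)).trans_eq ?_
    ring
  · refine b.one_of_mem_closedBall ?_
    rw [Metric.mem_closedBall, habs, div_le_iff₀ hk, abs_le]
    have := abs_le.1 (hhd x).1
    have := dist_nonneg (x := x) (y := x₀)
    constructor <;> simp only [b] <;> linarith

end TestFunctions

/-! ### Elementary bounds for W₁ and for convex α. -/

section Wasserstein

lemma isProbabilityMeasure_withDensity_div {X : Type*} [MeasurableSpace X] {μ : Measure X}
    {f : X → ℝ} (hf : Integrable f μ)
    (h0 : ∀ x, 0 ≤ f x) (hpos : 0 < ∫ x, f x ∂μ) :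
    IsProbabilityMeasure (μ.withDensity fun x => ENNReal.ofReal (f x / ∫ x, f x ∂μ)) := by
  refine ⟨?_⟩
  rw [withDensity_apply _ MeasurableSet.univ, Measure.restrict_univ,
    ← ofReal_integral_eq_lintegral_ofReal (hf.div_const _)
      (Eventually.of_forall fun x => div_nonneg (h0 x) hpos.le), integral_div,
    div_self hpos.ne', ENNReal.ofReal_one]

variable {X : Type*} [MetricSpace X] [MeasurableSpace X]

/-- The easy half of Kantorovich duality: integrate g(x) - g(y) ≤ d(x, y) against any coupling. -/
lemma ofReal_integral_sub_le_wasserstein1 {ν μ : Measure X} {g : X → ℝ} (hg : LipschitzWith 1 g)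
    (hν : Integrable g ν) (hμ : Integrable g μ) :
    ENNReal.ofReal (∫ x, g x ∂ν - ∫ x, g x ∂μ) ≤ wasserstein1 ν μ := by
  refine le_iInf₂ fun c hc => ?_
  obtain ⟨rfl, rfl⟩ := hc
  rw [integral_map measurable_fst.aemeasurable hν.aestronglyMeasurable,
    integral_map measurable_snd.aemeasurable hμ.aestronglyMeasurable,
    ← integral_sub (f := fun z : X × X => g z.1) (g := fun z : X × X => g z.2)
      (hν.comp_measurable measurable_fst) (hμ.comp_measurable measurable_snd)]
  calc _ ≤ ‖∫ z, (g z.1 - g z.2) ∂c‖ₑ := by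
        rw [← ofReal_norm]
        exact ENNReal.ofReal_le_ofReal (le_abs_self _)
    _ ≤ ∫⁻ z, ‖g z.1 - g z.2‖ₑ ∂c := enorm_integral_le_lintegral_enorm _
    _ ≤ ∫⁻ z, edist z.1 z.2 ∂c := lintegral_mono fun z => by
        rw [← edist_eq_enorm_sub]
        simpa using hg z.1 z.2

lemma extendTop_coe (φ : ℝ≥0 → ℝ≥0∞) (t : ℝ≥0) : extendTop φ t = φ t := by
  simp [extendTop]

lemma extendTop_mono {φ : ℝ≥0 → ℝ≥0∞} (hφ : Monotone φ) : Monotone (extendTop φ) := by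
  intro a b hab
  by_cases hb : b = ⊤
  · rw [extendTop, extendTop, if_pos hb]
    split_ifs
    · exact le_rfl
    · exact le_iSup φ _
  · have ha : a ≠ ⊤ := fun h => hb (top_le_iff.1 (h ▸ hab))
    rw [extendTop, extendTop, if_neg ha, if_neg hb]
    exact hφ (ENNReal.toNNReal_mono hb hab)

/-- A convex function vanishing at `0` which is not identically `0` is unbounded. -/
lemma extendTop_top_of_convex {α : ℝ≥0 → ℝ≥0∞} (hconv : ConvexOn ℝ≥0 Set.univ α) (h0 : α 0 = 0)
    {r : ℝ≥0} (hr : α r ≠ 0) : extendTop α ⊤ = ⊤ := by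
  rw [extendTop, if_pos rfl]
  by_contra htop
  have hN : ∀ N : ℕ, (N + 1 : ℝ≥0∞) * α r ≤ ⨆ s, α s := fun N => by
    have hN0 : (N + 1 : ℝ≥0) ≠ 0 := by positivity
    have hle : (N + 1 : ℝ≥0)⁻¹ ≤ 1 := inv_le_one_of_one_le₀ (by simp)
    -- Here r is a convex combination of (N + 1) r and 0, so α((N + 1) r) ≥ (N + 1) α(r).
    have := hconv.2 (Set.mem_univ ((N + 1) * r)) (Set.mem_univ 0) (zero_le (a := (N + 1 : ℝ≥0)⁻¹))
      (zero_le (a := 1 - (N + 1 : ℝ≥0)⁻¹)) (add_tsub_cancel_of_le hle)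
    simp only [smul_eq_mul, mul_zero, add_zero, h0, smul_zero, inv_mul_cancel_left₀ hN0] at this
    have h2 : (N + 1 : ℝ≥0∞) * α r ≤ α ((N + 1) * r) := by
      calc (N + 1 : ℝ≥0∞) * α r ≤ (N + 1 : ℝ≥0∞) * ((N + 1 : ℝ≥0)⁻¹ • α ((N + 1) * r)) := by gcongr
        _ = (N + 1 : ℝ≥0) • ((N + 1 : ℝ≥0)⁻¹ • α ((N + 1) * r)) := by
            rw [ENNReal.smul_def (N + 1 : ℝ≥0)]; simp
        _ = α ((N + 1) * r) := smul_inv_smul₀ hN0 _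
    exact h2.trans (le_iSup α _)
  have hlim : Tendsto (fun N : ℕ => (N + 1 : ℝ≥0∞) * α r) atTop (𝓝 (⊤ * α r)) := by
    refine ENNReal.Tendsto.mul_const ?_ (Or.inl ENNReal.top_ne_zero)
    have := ENNReal.tendsto_nat_nhds_top.comp (tendsto_add_atTop_nat 1)
    simpa [Function.comp_def] using this
  rw [ENNReal.top_mul hr] at hlim
  exact htop (top_le_iff.1 (le_of_tendsto hlim (Eventually.of_forall hN)))

end Wasserstein

/-! ### The differential inequality along exponential families. -/

section Limit

variable {n : ℕ} {M : Type*} [MetricSpace M] [ChartedSpace (EuclideanSpace ℝ (Fin n)) M]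
  [RiemannianBundle (fun x : M => TangentSpace (𝓡 n) x)] [MeasurableSpace M] [BorelSpace M]

/-- The test function is χ e^{s h + c}, with c chosen so that e^{2c} = 1/A normalizes its square.
Its gradient is at most (a + s b) e^{s h + c}. -/
lemma fisherInformation_cutoff_exp_le {μ : Measure M} [IsProbabilityMeasure μ] {χ h : M → ℝ}
    (hχ : ContMDiff (𝓡 n) 𝓘(ℝ, ℝ) ∞ χ) (hc : HasCompactSupport χ)
    (hh : ContMDiff (𝓡 n) 𝓘(ℝ, ℝ) ∞ h) {a b s : ℝ} (ha : 0 ≤ a) (hb : 0 ≤ b) (hs : 0 ≤ s)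
    (hχa : ∀ x, 0 ≤ χ x ∧ χ x ≤ 1 ∧ gradNorm n χ x ≤ ENNReal.ofReal a)
    (hhb : ∀ x, gradNorm n h x ≤ ENNReal.ofReal b)
    (hint : Integrable (fun x => Real.exp (2 * s * h x)) μ) {A : ℝ} (hA : 0 < A) :
    fisherInformation n (μ.withDensity fun x =>
        ENNReal.ofReal (χ x ^ 2 * Real.exp (2 * s * h x) / A)) μ ≤
      ENNReal.ofReal ((a + s * b) ^ 2 * (∫ x, Real.exp (2 * s * h x) ∂μ) / A) := by
  let c : ℝ := -Real.log A / 2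
  let φ : M → ℝ := fun x => χ x * Real.exp (s * h x + c)
  have hexp : ∀ x, Real.exp (s * h x + c) ^ 2 = Real.exp (2 * s * h x) / A := fun x => by
    rw [← Real.exp_nat_mul, div_eq_mul_inv, ← Real.exp_log (inv_pos.2 hA), ← Real.exp_add,
      Real.log_inv]
    congr 1
    simp only [c]
    push_cast
    ring
  have hφ : ContMDiff (𝓡 n) 𝓘(ℝ, ℝ) ∞ φ := by
    have hθ : ContDiff ℝ ∞ fun t : ℝ => Real.exp (s * t + c) := by fun_prop
    exact hχ.mul (hθ.contMDiff.comp hh)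
  have hφc : HasCompactSupport φ := hc.mul_right
  have hsq : ∀ x, φ x ^ 2 = χ x ^ 2 * Real.exp (2 * s * h x) / A := fun x => by
    rw [mul_pow, hexp, mul_div_assoc]
  have key := fisherInformation_le_preEnergy (μ := μ) hφ hφc
    fun x => mul_nonneg (hχa x).1 (Real.exp_pos _).le
  simp only [hsq] at key
  refine key.trans ?_
  calc preEnergy n μ φ
      ≤ ∫⁻ x, ENNReal.ofReal ((a + s * b) ^ 2 / A * Real.exp (2 * s * h x)) ∂μ := by
        refine lintegral_mono fun x => ?_
        have := gradNorm_mul_exp_le (n := n) (hχ.mdifferentiableAt (by simp))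
          (hh.mdifferentiableAt (by simp)) (hχa x).1 (hχa x).2.1 ha hb hs (c := c) (hχa x).2.2
          (hhb x)
        refine (pow_le_pow_left' this 2).trans_eq ?_
        rw [← ENNReal.ofReal_pow (by positivity), mul_pow, hexp]
        congr 1
        ring
    _ = _ := by
        rw [← ofReal_integral_eq_lintegral_ofReal (hint.const_mul _)
          (Eventually.of_forall fun x => by positivity), integral_const_mul]
        congr 1
        ring

end Limit

section Limit

variable {n : ℕ} {M : Type*} [MetricSpace M] [ChartedSpace (EuclideanSpace ℝ (Fin n)) M]
  [RiemannianBundle (fun x : M => TangentSpace (𝓡 n) x)] [MeasurableSpace M] [BorelSpace M]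
  [IsManifold (𝓡 n) ∞ M]
  [IsContMDiffRiemannianBundle (𝓡 n) ∞ (EuclideanSpace ℝ (Fin n))
      (fun x : M => TangentSpace (𝓡 n) x)]
  [ProperSpace M] [IsRiemannianManifold (𝓡 n) M]

/-- The transport-information inequality along the exponential family of a bounded Lipschitz
function. -/
lemma le_of_lt_integral_tilted {μ : Measure M} [IsProbabilityMeasure μ] {α : ℝ≥0 → ℝ≥0∞}
    (hα : Monotone α) (hW : SatisfiesW1I n α μ) {g : M → ℝ} (hg : LipschitzWith 1 g) {B : ℝ}
    (hB : ∀ x, |g x| ≤ B) {l : ℝ} (hl : 0 ≤ l) {t : ℝ≥0}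
    (ht : t < ∫ x, g x ∂(μ.tilted fun x => l * g x) - ∫ x, g x ∂μ) :
    α t ≤ ENNReal.ofReal (l ^ 2 / 4) := by
  have hne : Nonempty M := nonempty_of_isProbabilityMeasure μ
  obtain ⟨x₀⟩ := hne
  obtain ⟨C, hC, hcut⟩ := exists_smooth_cutoff (n := n) x₀
  choose χ hχs hχc hχ hχ1 using hcut
  choose h hhs hh using fun k : ℕ =>
    exists_smooth_approx (n := n) hg (Nat.one_div_pos_of_nat (α := ℝ) (n := k))
  -- The density is the square of the test function, so the exponent is halved; this is the source
  -- of the 1/4 in l²/4.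
  let s : ℝ := l / 2
  have hs : 0 ≤ s := by positivity
  have h2s : 2 * s = l := by simp only [s]; ring
  have hε0 : Tendsto (fun k : ℕ => 1 / ((k : ℝ) + 1)) atTop (𝓝 0) :=
    tendsto_one_div_add_atTop_nhds_zero_nat
  have hε1 : ∀ k : ℕ, 1 / ((k : ℝ) + 1) ≤ 1 := fun k => by
    rw [div_le_one (by positivity)]
    linarith [(Nat.cast_nonneg k : (0 : ℝ) ≤ k)]
  have hhlim : ∀ x, Tendsto (fun k => h k x) atTop (𝓝 (g x)) := fun x => by
    rw [tendsto_iff_dist_tendsto_zero]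
    exact squeeze_zero (fun _ => dist_nonneg) (fun k => (hh k x).1) hε0
  have hhB : ∀ k x, l * h k x ≤ l * (B + 1) := fun k x => by
    refine mul_le_mul_of_nonneg_left ?_ hl
    linarith [(abs_le.1 (hh k x).1).2, (abs_le.1 (hB x)).2, hε1 k]
  have hχlim : ∀ x, Tendsto (fun k => χ k x) atTop (𝓝 1) := fun x => by
    obtain ⟨m, hm⟩ := exists_nat_ge (dist x x₀)
    refine tendsto_atTop_of_eventually_const (i₀ := m) fun k hk => hχ1 k x (hm.trans ?_)
    exact_mod_cast hk
  have hχ2 : ∀ k x, 0 ≤ χ k x ^ 2 ∧ χ k x ^ 2 ≤ 1 := fun k x =>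
    ⟨sq_nonneg _, pow_le_one₀ (hχ k x).1 (hχ k x).2.1⟩
  have hexplim : ∀ x, Tendsto (fun k => Real.exp (l * h k x)) atTop (𝓝 (Real.exp (l * g x))) :=
    fun x => ((hhlim x).const_mul l).rexp
  have hmh : ∀ k, Continuous fun x => Real.exp (l * h k x) := fun k =>
    ((hhs k).continuous.const_mul l).rexp
  have hmχ : ∀ k, Continuous fun x => χ k x ^ 2 * Real.exp (l * h k x) := fun k =>
    ((hχs k).continuous.pow 2).mul (hmh k)
  have hE : Tendsto (fun k => ∫ x, Real.exp (l * h k x) ∂μ) atTop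
      (𝓝 (∫ x, Real.exp (l * g x) ∂μ)) := by
    refine tendsto_integral_of_dominated_convergence (fun _ => Real.exp (l * (B + 1)))
      (fun k => (hmh k).aestronglyMeasurable) (integrable_const _)
      (fun k => Eventually.of_forall fun x => ?_) (Eventually.of_forall hexplim)
    rw [Real.norm_of_nonneg (Real.exp_pos _).le]
    exact Real.exp_le_exp.2 (hhB k x)
  have hbound : ∀ k x, ‖χ k x ^ 2 * Real.exp (l * h k x)‖ ≤ Real.exp (l * (B + 1)) :=
    fun k x => by
      rw [Real.norm_of_nonneg (mul_nonneg (hχ2 k x).1 (Real.exp_pos _).le)]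
      exact (mul_le_of_le_one_left (Real.exp_pos _).le (hχ2 k x).2).trans
        (Real.exp_le_exp.2 (hhB k x))
  have hχexplim : ∀ x, Tendsto (fun k => χ k x ^ 2 * Real.exp (l * h k x)) atTop
      (𝓝 (Real.exp (l * g x))) := fun x => by
    simpa using ((hχlim x).pow 2).mul (hexplim x)
  have hA : Tendsto (fun k => ∫ x, χ k x ^ 2 * Real.exp (l * h k x) ∂μ) atTop
      (𝓝 (∫ x, Real.exp (l * g x) ∂μ)) :=
    tendsto_integral_of_dominated_convergence (fun _ => Real.exp (l * (B + 1)))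
      (fun k => (hmχ k).aestronglyMeasurable) (integrable_const _)
      (fun k => Eventually.of_forall (hbound k)) (Eventually.of_forall hχexplim)
  have hG : Tendsto (fun k => ∫ x, χ k x ^ 2 * Real.exp (l * h k x) * g x ∂μ) atTop
      (𝓝 (∫ x, Real.exp (l * g x) * g x ∂μ)) := by
    refine tendsto_integral_of_dominated_convergence (fun _ => Real.exp (l * (B + 1)) * B)
      (fun k => ((hmχ k).mul hg.continuous).aestronglyMeasurable) (integrable_const _)
      (fun k => Eventually.of_forall fun x => ?_)
      (Eventually.of_forall fun x => (hχexplim x).mul_const _)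
    rw [norm_mul]
    exact mul_le_mul (hbound k x) (hB x) (norm_nonneg _) (Real.exp_pos _).le
  have hgint : ∀ ρ : Measure M, IsFiniteMeasure ρ → Integrable g ρ := fun ρ _ =>
    Integrable.of_bound hg.continuous.aestronglyMeasurable B (Eventually.of_forall hB)
  have hexpint : Integrable (fun x => Real.exp (l * g x)) μ :=
    Integrable.of_bound (hg.continuous.const_mul l).rexp.aestronglyMeasurable
      (Real.exp (l * B)) (Eventually.of_forall fun x => by
        rw [Real.norm_of_nonneg (Real.exp_pos _).le]
        exact Real.exp_le_exp.2 (mul_le_mul_of_nonneg_left (abs_le.1 (hB x)).2 hl))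
  have hZ : 0 < ∫ x, Real.exp (l * g x) ∂μ := integral_exp_pos hexpint
  have htilt : ∫ x, g x ∂(μ.tilted fun x => l * g x) =
      (∫ x, Real.exp (l * g x) * g x ∂μ) / ∫ x, Real.exp (l * g x) ∂μ := by
    rw [integral_tilted, ← integral_div]
    refine integral_congr_ae (Eventually.of_forall fun x => ?_)
    simp only [smul_eq_mul]
    ring
  -- The strict inequality on the means is open, hence holds eventually along the approximations; no
  -- continuity of α is needed.
  have hmean := ((hG.div hA hZ.ne').sub_const (∫ x, g x ∂μ)).eventually_const_lt (htilt ▸ ht)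
  have hR : Tendsto (fun k : ℕ => (C / (k + 1) + s * (1 + 1 / (k + 1))) ^ 2 *
      (∫ x, Real.exp (l * h k x) ∂μ) / ∫ x, χ k x ^ 2 * Real.exp (l * h k x) ∂μ) atTop
      (𝓝 (l ^ 2 / 4)) := by
    have h1 : Tendsto (fun k : ℕ => (C / (k + 1) + s * (1 + 1 / ((k : ℝ) + 1))) ^ 2) atTop
        (𝓝 (s ^ 2)) := by
      have := (((hε0.const_mul C).add ((hε0.const_add 1).const_mul s)).pow 2)
      simpa [div_eq_mul_inv] using this
    have h2 := (h1.mul hE).div hA hZ.ne'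
    rw [mul_div_assoc, div_self hZ.ne', mul_one] at h2
    have hs2 : l ^ 2 / 4 = s ^ 2 := by simp only [s]; ring
    rw [hs2]
    exact h2
  refine ge_of_tendsto ((ENNReal.continuous_ofReal.tendsto _).comp hR) ?_
  filter_upwards [hmean, hA.eventually_const_lt hZ] with k hk hAk
  simp only [Pi.div_apply] at hk
  set A := ∫ x, χ k x ^ 2 * Real.exp (l * h k x) ∂μ with hAdef
  have hint1 : Integrable (fun x => χ k x ^ 2 * Real.exp (l * h k x)) μ :=
    Integrable.of_bound (hmχ k).aestronglyMeasurable _ (Eventually.of_forall (hbound k))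
  have hint2 : Integrable (fun x => Real.exp (l * h k x)) μ :=
    Integrable.of_bound (hmh k).aestronglyMeasurable (Real.exp (l * (B + 1)))
      (Eventually.of_forall fun x => by
        rw [Real.norm_of_nonneg (Real.exp_pos _).le]
        exact Real.exp_le_exp.2 (hhB k x))
  have hprob := isProbabilityMeasure_withDensity_div hint1
    (fun x => mul_nonneg (hχ2 k x).1 (Real.exp_pos _).le) hAk
  rw [← hAdef] at hprob
  have hI := fisherInformation_cutoff_exp_le (n := n) (μ := μ) (hχs k) (hχc k) (hhs k)
    (a := C / (k + 1)) (b := 1 + 1 / (k + 1)) (by positivity) (by positivity) hs (hχ k)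
    (fun x => (hh k x).2) (by simpa only [h2s] using hint2) hAk
  simp only [h2s] at hI
  refine le_trans ?_ ((hW _ hprob).trans hI)
  rw [← extendTop_coe α t]
  refine extendTop_mono hα (le_trans ?_ (ofReal_integral_sub_le_wasserstein1 hg
    (hgint _ inferInstance) (hgint _ inferInstance)))
  rw [← ENNReal.ofReal_coe_nnreal]
  refine ENNReal.ofReal_le_ofReal (hk.le.trans_eq ?_)
  congr 1
  rw [integral_withDensity_eq_integral_toReal_smul
    (by exact ((hmχ k).div_const A).measurable.ennreal_ofReal)
    (Eventually.of_forall fun x => ENNReal.ofReal_lt_top), ← integral_div]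
  refine integral_congr_ae (Eventually.of_forall fun x => ?_)
  simp only [smul_eq_mul]
  rw [ENNReal.toReal_ofReal (div_nonneg (mul_nonneg (hχ2 k x).1 (Real.exp_pos _).le) hAk.le)]
  ring

/-- Under a nontrivial transport-information inequality, Lipschitz functions are integrable. -/
lemma integrable_of_lipschitz {μ : Measure M} [IsProbabilityMeasure μ] {α : ℝ≥0 → ℝ≥0∞}
    (hα : extendTop α ⊤ = ⊤) (hW : SatisfiesW1I n α μ) {g : M → ℝ} (hg : LipschitzWith 1 g) :
    Integrable g μ := by
  have hne : Nonempty M := nonempty_of_isProbabilityMeasure μ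
  obtain ⟨x₀⟩ := hne
  obtain ⟨C, hC, hcut⟩ := exists_smooth_cutoff (n := n) x₀
  choose χ hχs hχc hχ hχ1 using hcut
  have hχlim : ∀ x, Tendsto (fun k => χ k x) atTop (𝓝 1) := fun x => by
    obtain ⟨m, hm⟩ := exists_nat_ge (dist x x₀)
    refine tendsto_atTop_of_eventually_const (i₀ := m) fun k hk => hχ1 k x (hm.trans ?_)
    exact_mod_cast hk
  have hχ2 : ∀ k x, 0 ≤ χ k x ^ 2 ∧ χ k x ^ 2 ≤ 1 := fun k x =>
    ⟨sq_nonneg _, pow_le_one₀ (hχ k x).1 (hχ k x).2.1⟩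
  have hA : Tendsto (fun k => ∫ x, χ k x ^ 2 ∂μ) atTop (𝓝 1) := by
    have := tendsto_integral_of_dominated_convergence (μ := μ) (F := fun k x => χ k x ^ 2)
      (f := fun _ => 1) (fun _ => (1 : ℝ))
      (fun k => ((hχs k).continuous.pow 2).aestronglyMeasurable) (integrable_const _)
      (fun k => Eventually.of_forall fun x => by
        rw [Real.norm_of_nonneg (hχ2 k x).1]; exact (hχ2 k x).2)
      (Eventually.of_forall fun x => by simpa using (hχlim x).pow 2)
    simpa using this
  obtain ⟨k, hk⟩ := (hA.eventually_const_lt one_pos).exists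
  set A := ∫ x, χ k x ^ 2 ∂μ with hAdef
  have hcont : Continuous fun x => χ k x ^ 2 := (hχs k).continuous.pow 2
  have hint : Integrable (fun x => χ k x ^ 2) μ :=
    Integrable.of_bound hcont.aestronglyMeasurable 1 (Eventually.of_forall fun x => by
      rw [Real.norm_of_nonneg (hχ2 k x).1]; exact (hχ2 k x).2)
  have hprob := isProbabilityMeasure_withDensity_div hint (fun x => (hχ2 k x).1) hk
  rw [← hAdef] at hprob
  set ν := μ.withDensity fun x => ENNReal.ofReal (χ k x ^ 2 / A)
  -- With h = 0 this is the measure χ² μ / A: it has compact support and finite Fisher information,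
  -- hence finite distance to μ because α(+∞) = +∞.
  have hI := fisherInformation_cutoff_exp_le (n := n) (μ := μ) (hχs k) (hχc k)
    (h := fun _ => 0) contMDiff_const (a := C / (k + 1)) (b := 0) (by positivity) le_rfl
    (le_refl 0) (hχ k) (fun x => by
      rw [gradNorm_eq_ofReal, mvfderiv_const, ContinuousLinearMap.opNorm_zero]) (by simp) hk
  simp only [mul_zero, Real.exp_zero, mul_one] at hI
  have hfin : wasserstein1 ν μ ≠ ⊤ := fun htop => by
    have := (hW ν hprob).trans hI
    rw [htop, hα, top_le_iff] at this
    exact ENNReal.ofReal_ne_top this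
  obtain ⟨c, hc⟩ := iInf_lt_iff.1 hfin.lt_top
  obtain ⟨⟨hc1, hc2⟩, hc⟩ := iInf_lt_iff.1 hc
  obtain ⟨R, hR⟩ := (hχc k).isBounded.subset_closedBall x₀
  have hν : ∫⁻ x, edist x x₀ ∂ν < ⊤ := by
    have hae : ∀ᵐ x ∂ν, edist x x₀ ≤ ENNReal.ofReal R := by
      rw [ae_withDensity_iff (hcont.div_const A).measurable.ennreal_ofReal]
      refine Eventually.of_forall fun x hx => ?_
      have : x ∈ tsupport (χ k) := by
        by_contra hn
        simp [image_eq_zero_of_notMem_tsupport hn] at hx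
      rw [edist_dist]
      exact ENNReal.ofReal_le_ofReal (hR this)
    refine (lintegral_mono_ae hae).trans_lt ?_
    simp
  -- The triangle inequality along a coupling of finite cost transfers the finite first moment from
  -- ν to μ.
  have hμ : ∫⁻ x, edist x x₀ ∂μ < ⊤ := by
    have hm : Measurable fun x : M => edist x x₀ := by fun_prop
    calc ∫⁻ x, edist x x₀ ∂μ = ∫⁻ z, edist z.2 x₀ ∂c := by
          rw [← hc2, lintegral_map hm measurable_snd]
      _ ≤ ∫⁻ z, (edist z.1 z.2 + edist z.1 x₀) ∂c := lintegral_mono fun z => by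
          rw [edist_comm z.1 z.2]
          exact edist_triangle _ _ _
      _ = ∫⁻ z, edist z.1 z.2 ∂c + ∫⁻ x, edist x x₀ ∂ν := by
          rw [lintegral_add_right (g := fun z : M × M => edist z.1 x₀) _ (hm.comp measurable_fst), ← hc1,
            lintegral_map hm measurable_fst]
      _ < ⊤ := ENNReal.add_lt_top.2 ⟨hc, hν⟩
  have hdist : Integrable (fun x => dist x x₀) μ := by
    refine ⟨by fun_prop, ?_⟩
    rw [hasFiniteIntegral_iff_ofReal (Eventually.of_forall fun x => dist_nonneg)]
    simpa only [edist_dist] using hμ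
  refine (hdist.add (integrable_const |g x₀|)).mono' hg.continuous.aestronglyMeasurable
    (Eventually.of_forall fun x => ?_)
  have h1 := hg.dist_le_mul x x₀
  rw [NNReal.coe_one, one_mul, Real.dist_eq] at h1
  have h2 := abs_add_le (g x - g x₀) (g x₀)
  rw [sub_add_cancel] at h2
  simp only [Real.norm_eq_abs, Pi.add_apply]
  linarith

end Limit

/-! ### Entropy and the cumulant generating function -/

section Entropy

variable {X : Type*} [MeasurableSpace X] {μ ν : Measure X}

/-- The entropy inequality of Donsker and Varadhan for a bounded function. -/
lemma integral_sub_cgf_le_toReal_klDiv [IsProbabilityMeasure μ] [IsProbabilityMeasure ν]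
    (hH : InformationTheory.klDiv ν μ ≠ ⊤) {g : X → ℝ} (hg : Measurable g) {B : ℝ}
    (hB : ∀ x, |g x| ≤ B) (l : ℝ) :
    l * ∫ x, g x ∂ν - ProbabilityTheory.cgf g μ l ≤ (InformationTheory.klDiv ν μ).toReal := by
  obtain ⟨hac, hint⟩ := InformationTheory.klDiv_ne_top_iff.mp hH
  have hexp : Integrable (fun x => Real.exp (l * g x)) μ := by
    refine Integrable.of_bound (by fun_prop) (Real.exp (|l| * B)) (ae_of_all _ fun x => ?_)
    rw [Real.norm_eq_abs, Real.abs_exp]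
    refine Real.exp_le_exp.mpr ((le_abs_self _).trans ?_)
    rw [abs_mul]
    exact mul_le_mul_of_nonneg_left (hB x) (abs_nonneg l)
  have hgν : Integrable (fun x => l * g x) ν :=
    (Integrable.of_bound hg.aestronglyMeasurable B (ae_of_all _ hB)).const_mul l
  have := isProbabilityMeasure_tilted hexp
  -- The inequality is the nonnegativity of the entropy of ν relative to the tilted measure.
  have hpos := InformationTheory.integral_llr_add_sub_measure_univ_nonneg
    (hac.trans (absolutelyContinuous_tilted hexp))
    (integrable_llr_tilted_right hac hgν hint hexp)
  rw [integral_llr_tilted_right hac hgν hexp hint, integral_const_mul] at hpos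
  rw [InformationTheory.toReal_klDiv_of_measure_eq hac (by simp)]
  simp only [probReal_univ, add_sub_cancel_right] at hpos
  simp only [ProbabilityTheory.cgf, ProbabilityTheory.mgf]
  linarith

lemma integrableExpSet_of_bounded [IsFiniteMeasure μ] {g : X → ℝ} (hg : Measurable g) {B : ℝ}
    (hB : ∀ x, |g x| ≤ B) : ProbabilityTheory.integrableExpSet g μ = Set.univ := by
  refine Set.eq_univ_of_forall fun l => ?_
  refine Integrable.of_bound (by fun_prop) (Real.exp (|l| * B)) (ae_of_all _ fun x => ?_)
  rw [Real.norm_eq_abs, Real.abs_exp]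
  refine Real.exp_le_exp.mpr ((le_abs_self _).trans ?_)
  rw [abs_mul]
  exact mul_le_mul_of_nonneg_left (hB x) (abs_nonneg l)

/-- The relative entropy of a conditional measure. -/
lemma klDiv_cond_le [IsProbabilityMeasure μ] {A : Set X} (hA : MeasurableSet A) (h0 : μ A ≠ 0) :
    InformationTheory.klDiv (ProbabilityTheory.cond μ A) μ ≤
      ENNReal.ofReal (-Real.log (μ A).toReal) := by
  have := ProbabilityTheory.cond_isProbabilityMeasure h0
  have hac : ProbabilityTheory.cond μ A ≪ μ := ProbabilityTheory.cond_absolutelyContinuous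
  have hd : ProbabilityTheory.cond μ A = μ.withDensity (A.indicator fun _ => (μ A)⁻¹) := by
    rw [withDensity_indicator hA, withDensity_const, ProbabilityTheory.cond]
  have hrn : (ProbabilityTheory.cond μ A).rnDeriv μ =ᵐ[ProbabilityTheory.cond μ A]
      A.indicator fun _ => (μ A)⁻¹ := by
    refine hac.ae_eq ?_
    conv_lhs => rw [hd]
    exact Measure.rnDeriv_withDensity _ (measurable_const.indicator hA)
  have hllr : llr (ProbabilityTheory.cond μ A) μ =ᵐ[ProbabilityTheory.cond μ A]
      fun _ => -Real.log (μ A).toReal := by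
    filter_upwards [hrn, ProbabilityTheory.ae_cond_mem hA] with x hx hxA
    simp [llr, hx, hxA, Real.log_inv]
  rw [InformationTheory.klDiv_of_ac_of_integrable hac
    ((integrable_congr hllr).mpr (integrable_const _)), integral_congr_ae hllr]
  simp

end Entropy

/-! ### The function `α̃` -/

section AlphaTilde

variable {α : ℝ≥0 → ℝ≥0∞}

lemma alphaTilde_zero : alphaTilde α 0 = 0 := by simp [alphaTilde]

lemma alphaTilde_mono : Monotone (alphaTilde α) := fun _ _ h => by
  unfold alphaTilde
  gcongr

/-- Left continuity of α̃, by monotone convergence over (0, u k] with u k increasing to s; it holds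
even where α is infinite. -/
lemma alphaTilde_le_of_forall_lt {s : ℝ≥0} {H : ℝ≥0∞} (h : ∀ t < s, alphaTilde α t ≤ H) :
    alphaTilde α s ≤ H := by
  rcases eq_or_ne s 0 with rfl | hs
  · simp [alphaTilde_zero]
  obtain ⟨u, humono, hu, htend⟩ := exists_seq_strictMono_tendsto' (pos_iff_ne_zero.mpr hs)
  have hUnion : ⋃ k, Set.Ioc (0 : ℝ) (u k) = Set.Ioo (0 : ℝ) s := by
    ext x
    simp only [Set.mem_iUnion, Set.mem_Ioc, Set.mem_Ioo]
    constructor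
    · rintro ⟨k, hx, hxk⟩
      exact ⟨hx, hxk.trans_lt (by exact_mod_cast (hu k).2)⟩
    · rintro ⟨hx, hxs⟩
      obtain ⟨k, hk⟩ := (((NNReal.tendsto_coe.mpr htend).eventually_const_lt hxs)).exists
      exact ⟨k, hx, hk.le⟩
  have hdir : Directed (· ⊆ ·) fun k => Set.Ioc (0 : ℝ) (u k) :=
    directed_of_isDirected_le fun a b hab =>
      Set.Ioc_subset_Ioc_right (by exact_mod_cast humono.monotone hab)
  rw [alphaTilde, ← restrict_Ioo_eq_restrict_Ioc, ← hUnion,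
    setLIntegral_iUnion_of_directed _ hdir, ENNReal.mul_iSup]
  exact iSup_le fun k => h _ (hu k).2

end AlphaTilde

/-- A one-dimensional Legendre duality: the bound on the slope of `K` provided by `α` is
integrated. -/
lemma alphaTilde_le_of_forall_mul_sub_le {α : ℝ≥0 → ℝ≥0∞} (hα : Monotone α) {K : ℝ → ℝ}
    (hK : Differentiable ℝ K) (hK' : Continuous (deriv K)) (hK0 : K 0 = 0) {m H : ℝ}
    (hslope : ∀ l : ℝ, 0 ≤ l → ∀ t : ℝ≥0, (t : ℝ) < deriv K l - m →
      α t ≤ ENNReal.ofReal (l ^ 2 / 4))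
    {r : ℝ≥0} (hH : ∀ l : ℝ, 0 ≤ l → l * (m + r) - K l ≤ H) :
    alphaTilde α r ≤ ENNReal.ofReal H := by
  set q : ℝ → ℝ≥0∞ := fun t => 2 * α t.toNNReal ^ (1 / 2 : ℝ) with hq
  have hqmono : Monotone q := fun a b hab => by
    simp only [hq]
    gcongr
    exact hα (Real.toNNReal_le_toNNReal hab)
  have hqmeas : Measurable q := hqmono.measurable
  -- The slope bound, with square roots taken: 2√α(t) ≤ s for every t below K'(s) - m.
  have hq_le : ∀ s : ℝ, 0 ≤ s → ∀ t : ℝ, 0 ≤ t → t < deriv K s - m → q t ≤ ENNReal.ofReal s := by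
    intro s hs t ht hts
    have h1 := hslope s hs t.toNNReal (by rwa [Real.coe_toNNReal _ ht])
    calc q t ≤ 2 * ENNReal.ofReal (s ^ 2 / 4) ^ (1 / 2 : ℝ) := by
          simp only [hq]; gcongr
      _ = ENNReal.ofReal s := by
          rw [ENNReal.ofReal_rpow_of_nonneg (by positivity) (by norm_num),
            ← Real.sqrt_eq_rpow, show s ^ 2 / 4 = (s / 2) ^ 2 by ring,
            Real.sqrt_sq (by positivity), ← ENNReal.ofReal_ofNat, ← ENNReal.ofReal_mul (by norm_num)]
          congr 1; ring
  -- Truncation at N keeps the slope `l` below finite, since α may be infinite.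
  have key : ∀ N : ℕ, ∫⁻ t in Set.Ioc (0 : ℝ) r, min (q t) N ≤ ENNReal.ofReal H := by
    intro N
    have hfin : ∀ t, min (q t) (N : ℝ≥0∞) ≠ ⊤ := fun t =>
      ne_top_of_le_ne_top (ENNReal.natCast_ne_top N) (min_le_right _ _)
    -- The optimal slope in the Legendre transform is q(r), here truncated.
    set l : ℝ := (min (q r) (N : ℝ≥0∞)).toReal with hl
    have hl0 : 0 ≤ l := ENNReal.toReal_nonneg
    -- The indicator of the region under the graph of q. Tonelli computes its area in two ways: the
    -- slice at t has length at least min(q t, N), and the slice at s lies in [K'(s) - m, r].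
    set F : ℝ → ℝ → ℝ≥0∞ := fun t s => if ENNReal.ofReal s < q t then 1 else 0 with hF
    have hSmeas : MeasurableSet {z : ℝ × ℝ | ENNReal.ofReal z.2 < q z.1} :=
      measurableSet_lt (by fun_prop) (by fun_prop)
    have hFmeas : Measurable (Function.uncurry F) :=
      Measurable.ite hSmeas measurable_const measurable_const
    have hlayer : ∀ t ∈ Set.Ioc (0 : ℝ) r,
        min (q t) (N : ℝ≥0∞) ≤ ∫⁻ s in Set.Ioc 0 l, F t s := by
      intro t ht
      have hle : (min (q t) (N : ℝ≥0∞)).toReal ≤ l := by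
        refine ENNReal.toReal_mono (hfin r) (min_le_min_right _ (hqmono ht.2))
      have hEq : ∫⁻ s in Set.Ioc 0 l, F t s
          = volume ({s : ℝ | ENNReal.ofReal s < q t} ∩ Set.Ioc 0 l) := by
        have hS : MeasurableSet {s : ℝ | ENNReal.ofReal s < q t} :=
          measurableSet_lt (by fun_prop) measurable_const
        rw [← Measure.restrict_apply hS, ← lintegral_indicator_one hS]
        refine lintegral_congr fun _ => ?_
        simp [hF, Set.indicator_apply]
      rw [hEq]
      calc min (q t) (N : ℝ≥0∞)
          = volume (Set.Ioo 0 (min (q t) (N : ℝ≥0∞)).toReal) := by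
            rw [Real.volume_Ioo, sub_zero, ENNReal.ofReal_toReal (hfin t)]
        _ ≤ _ := by
            refine measure_mono fun s hs => ⟨?_, hs.1, hs.2.le.trans hle⟩
            exact ((ENNReal.ofReal_lt_iff_lt_toReal hs.1.le (hfin t)).mpr hs.2).trans_le
              (min_le_left _ _)
    have hinner : ∀ s ∈ Set.Ioc 0 l, ∫⁻ t in Set.Ioc (0 : ℝ) r, F t s
        ≤ ENNReal.ofReal (m + r - deriv K s) := by
      intro s hs
      have hS : MeasurableSet {t : ℝ | ENNReal.ofReal s < q t} :=
        measurableSet_lt measurable_const hqmeas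
      have hEq : ∫⁻ t in Set.Ioc (0 : ℝ) r, F t s
          = volume ({t : ℝ | ENNReal.ofReal s < q t} ∩ Set.Ioc 0 (r : ℝ)) := by
        rw [← Measure.restrict_apply hS, ← lintegral_indicator_one hS]
        refine lintegral_congr fun _ => ?_
        simp [hF, Set.indicator_apply]
      rw [hEq]
      calc volume ({t : ℝ | ENNReal.ofReal s < q t} ∩ Set.Ioc 0 (r : ℝ))
          ≤ volume (Set.Icc (deriv K s - m) r) := by
            refine measure_mono fun t ht => ⟨?_, ht.2.2⟩
            by_contra! hlt
            exact absurd (hq_le s hs.1.le t ht.2.1.le hlt) (not_le.mpr ht.1)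
        _ = _ := by rw [Real.volume_Icc]; congr 1; ring
    -- If K'(s) - m > r, then q(r) ≤ s, which is impossible for s < l. The endpoint s = l is not
    -- excluded by this argument, hence the almost everywhere statement.
    have hnonneg : ∀ᵐ s ∂(volume.restrict (Set.Ioc 0 l)), 0 ≤ m + r - deriv K s := by
      rw [← restrict_Ioo_eq_restrict_Ioc]
      filter_upwards [ae_restrict_mem measurableSet_Ioo] with s hs
      by_contra! hlt
      have h1 := hq_le s hs.1.le r r.2 (by linarith)
      have h2 : l ≤ s := ENNReal.toReal_le_of_le_ofReal hs.1.le ((min_le_left _ _).trans h1)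
      exact absurd hs.2 (not_lt.mpr h2)
    have hint : IntegrableOn (fun s => m + r - deriv K s) (Set.Ioc 0 l) := by
      have : Continuous fun s => m + r - deriv K s := by fun_prop
      exact (this.integrableOn_Icc).mono_set Set.Ioc_subset_Icc_self
    calc ∫⁻ t in Set.Ioc (0 : ℝ) r, min (q t) N
        ≤ ∫⁻ t in Set.Ioc (0 : ℝ) r, ∫⁻ s in Set.Ioc 0 l, F t s :=
          setLIntegral_mono' measurableSet_Ioc hlayer
      _ = ∫⁻ s in Set.Ioc 0 l, ∫⁻ t in Set.Ioc (0 : ℝ) r, F t s :=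
          lintegral_lintegral_swap hFmeas.aemeasurable
      _ ≤ ∫⁻ s in Set.Ioc 0 l, ENNReal.ofReal (m + r - deriv K s) :=
          setLIntegral_mono' measurableSet_Ioc hinner
      _ = ENNReal.ofReal (∫ s in Set.Ioc 0 l, (m + r - deriv K s)) :=
          (ofReal_integral_eq_lintegral_ofReal hint hnonneg).symm
      _ = ENNReal.ofReal (l * (m + r) - K l) := by
          congr 1
          rw [← intervalIntegral.integral_of_le hl0, intervalIntegral.integral_sub
            (by simp) (hK'.intervalIntegrable _ _), intervalIntegral.integral_const,
            intervalIntegral.integral_deriv_eq_sub (fun x _ => hK x)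
              (hK'.intervalIntegrable _ _), hK0]
          simp
      _ ≤ ENNReal.ofReal H := ENNReal.ofReal_le_ofReal (hH l hl0)
  calc alphaTilde α r = ∫⁻ t in Set.Ioc (0 : ℝ) r, q t := by
        rw [alphaTilde, ← lintegral_const_mul' _ _ (by simp)]
    _ = ∫⁻ t in Set.Ioc (0 : ℝ) r, ⨆ N : ℕ, min (q t) N := by
        congr 1 with t
        rw [← inf_iSup_eq, ENNReal.iSup_natCast, inf_top_eq]
    _ = ⨆ N : ℕ, ∫⁻ t in Set.Ioc (0 : ℝ) r, min (q t) N :=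
        lintegral_iSup (fun N => by fun_prop) fun a b hab t =>
          min_le_min_left _ (by exact_mod_cast hab)
    _ ≤ ENNReal.ofReal H := iSup_le key

/-! ### The transport-entropy inequality -/

section TransportEntropy

variable {n : ℕ} {M : Type*} [MetricSpace M] [ChartedSpace (EuclideanSpace ℝ (Fin n)) M]
  [RiemannianBundle (fun x : M => TangentSpace (𝓡 n) x)] [MeasurableSpace M] [BorelSpace M]
  [IsManifold (𝓡 n) ∞ M]
  [IsContMDiffRiemannianBundle (𝓡 n) ∞ (EuclideanSpace ℝ (Fin n))
      (fun x : M => TangentSpace (𝓡 n) x)]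
  [ProperSpace M] [IsRiemannianManifold (𝓡 n) M]
  {μ : Measure M} [IsProbabilityMeasure μ] {α : ℝ≥0 → ℝ≥0∞}

/-- Boundedness of g makes its cumulant generating function K analytic on the whole line, with K'(l)
the mean of g under the tilted measure. The slope bound and Donsker-Varadhan then feed the Legendre
duality. -/
lemma alphaTilde_le_klDiv_of_lt_integral_sub (hα : Monotone α) (hW : SatisfiesW1I n α μ)
    {ν : Measure M} [IsProbabilityMeasure ν] {g : M → ℝ} (hg : LipschitzWith 1 g) {B : ℝ}
    (hB : ∀ x, |g x| ≤ B) {r : ℝ≥0} (hr : r < ∫ x, g x ∂ν - ∫ x, g x ∂μ) :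
    alphaTilde α r ≤ InformationTheory.klDiv ν μ := by
  rcases eq_or_ne (InformationTheory.klDiv ν μ) ⊤ with htop | hH
  · simp [htop]
  have hmeas : Measurable g := hg.continuous.measurable
  have hset : ∀ l, l ∈ interior (ProbabilityTheory.integrableExpSet g μ) := fun l => by
    simp [integrableExpSet_of_bounded hmeas hB]
  have han : AnalyticOnNhd ℝ (ProbabilityTheory.cgf g μ) Set.univ := fun l _ =>
    ProbabilityTheory.analyticAt_cgf (hset l)
  rw [← ENNReal.ofReal_toReal hH]
  refine alphaTilde_le_of_forall_mul_sub_le hα (K := ProbabilityTheory.cgf g μ)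
    (fun l => (han l trivial).differentiableAt)
    (continuousOn_univ.mp han.deriv.continuousOn) (by simp) (m := ∫ x, g x ∂μ)
    (fun l hl t ht => ?_) fun l hl => ?_
  · refine le_of_lt_integral_tilted hα hW hg hB hl ?_
    rwa [ProbabilityTheory.integral_tilted_mul_self (hset l)]
  · refine le_trans ?_ (integral_sub_cgf_le_toReal_klDiv hH hmeas hB l)
    have := mul_le_mul_of_nonneg_left hr.le hl
    linarith

theorem satisfiesW1H_alphaTilde (hα : Monotone α) (hW : SatisfiesW1I n α μ) :
    SatisfiesW1H (alphaTilde α) μ := by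
  intro ν hν
  have hlt : ∀ t : ℝ≥0, (t : ℝ≥0∞) < wasserstein1 ν μ →
      alphaTilde α t ≤ InformationTheory.klDiv ν μ := by
    intro t ht
    by_contra! hcon
    refine absurd ht (not_lt.mpr ?_)
    rw [← ENNReal.ofReal_coe_nnreal]
    -- Duality with `D = t`, used in contrapositive form: if W₁ > t, some bounded 1-Lipschitz g has
    -- ν(g) - μ(g) > t.
    refine wasserstein1_le_of_forall_lipschitz fun g hg => ?_
    by_contra! hlt
    exact absurd (alphaTilde_le_klDiv_of_lt_integral_sub hα hW hg (B := ‖g‖)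
      (fun x => g.norm_coe_le_norm x) hlt) (not_le.mpr hcon)
  rcases eq_or_ne (wasserstein1 ν μ) ⊤ with htop | hfin
  · rw [extendTop, if_pos htop]
    exact iSup_le fun t => hlt t (by simp [htop])
  · rw [extendTop, if_neg hfin]
    refine alphaTilde_le_of_forall_lt fun t ht => hlt t ?_
    rwa [← ENNReal.coe_toNNReal hfin, ENNReal.coe_lt_coe]

omit [RiemannianBundle (fun x : M => TangentSpace (𝓡 n) x)]
  [ChartedSpace (EuclideanSpace ℝ (Fin n)) M] [ProperSpace M] in
/-- The deviation inequality implied by a transport-entropy inequality. -/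
theorem measure_integral_add_lt_le {β : ℝ≥0 → ℝ≥0∞} (hβ : Monotone β)
    (hW : SatisfiesW1H β μ) {g : M → ℝ} (hg : LipschitzWith 1 g) (hint : Integrable g μ)
    (r : ℝ≥0) :
    μ {x | (∫ y, g y ∂μ) + r < g x} ≤ EReal.exp (-(β r : EReal)) := by
  set A : Set M := {x | (∫ y, g y ∂μ) + r < g x} with hA
  have hAm : MeasurableSet A := measurableSet_lt measurable_const hg.continuous.measurable
  rcases eq_or_ne (μ A) 0 with h0 | h0
  · simp [h0]
  have hprob := ProbabilityTheory.cond_isProbabilityMeasure h0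
  have hintA : Integrable g (ProbabilityTheory.cond μ A) :=
    (hint.restrict (s := A)).smul_measure (ENNReal.inv_ne_top.mpr h0)
  have hmean : (∫ y, g y ∂μ) + r ≤ ∫ x, g x ∂(ProbabilityTheory.cond μ A) := by
    have := integral_mono_ae (integrable_const ((∫ y, g y ∂μ) + (r : ℝ))) hintA
      ((ProbabilityTheory.ae_cond_mem hAm).mono fun x hx => le_of_lt hx)
    simpa using this
  have hr : (r : ℝ≥0∞) ≤ wasserstein1 (ProbabilityTheory.cond μ A) μ := by
    refine le_trans ?_ (ofReal_integral_sub_le_wasserstein1 hg hintA hint)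
    rw [← ENNReal.ofReal_coe_nnreal]
    exact ENNReal.ofReal_le_ofReal (by linarith)
  have hle : β r ≤ ENNReal.ofReal (-Real.log (μ A).toReal) := by
    rw [← extendTop_coe β r]
    exact (extendTop_mono hβ hr).trans ((hW _ hprob).trans (klDiv_cond_le hAm h0))
  have hlog : Real.log (μ A).toReal ≤ 0 :=
    Real.log_nonpos ENNReal.toReal_nonneg measureReal_le_one
  have hE : (β r : EReal) ≤ ((-Real.log (μ A).toReal : ℝ) : EReal) := by
    rw [← max_eq_left (neg_nonneg.mpr hlog), ← EReal.coe_ennreal_ofReal]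
    exact_mod_cast hle
  have hfinal : ENNReal.log (μ A) ≤ -(β r : EReal) := by
    rw [ENNReal.log_pos_real h0 (measure_ne_top μ A), EReal.le_neg]
    simpa using hE
  calc μ A = EReal.exp (ENNReal.log (μ A)) := (ENNReal.exp_log _).symm
    _ ≤ _ := EReal.exp_monotone hfinal

end TransportEntropy

end TransportInformation

/-! ### The theorem for the Gibbs measure. -/

theorem proposition2p1 (n : ℕ) {M : Type*} [MetricSpace M] [CompleteSpace M] [ConnectedSpace M]
    [SecondCountableTopology M] [MeasurableSpace M] [BorelSpace M]
    [ChartedSpace (EuclideanSpace ℝ (Fin n)) M] [IsManifold (𝓡 n) ∞ M]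
    [RiemannianBundle (fun x : M => TangentSpace (𝓡 n) x)]
    [IsContMDiffRiemannianBundle (𝓡 n) ∞ (EuclideanSpace ℝ (Fin n))
      (fun x : M => TangentSpace (𝓡 n) x)]
    [IsRiemannianManifold (𝓡 n) M]
    (V : M → ℝ) (hV : ContMDiff (𝓡 n) 𝓘(ℝ, ℝ) 1 V)
    (hZ : TransportInformation.partitionFunction n V ≠ ⊤)
    (μ : Measure M) (hμ : μ = TransportInformation.gibbsMeasure n V)
    (α : ℝ≥0 → ℝ≥0∞) (hα_leftCont : ∀ r, ContinuousWithinAt α (Set.Iic r) r)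
    (hα_mono : Monotone α) (hα_conv : ConvexOn ℝ≥0 Set.univ α) (hα_zero : α 0 = 0)
    (hW1I : TransportInformation.SatisfiesW1I n α μ) :
    TransportInformation.SatisfiesW1H (TransportInformation.alphaTilde α) μ ∧
      ∀ g : M → ℝ, LipschitzWith 1 g →
        ((∃ r, α r ≠ 0) → Integrable g μ) ∧
        ∀ r : ℝ≥0, 0 < r →
          μ {x | (∫ y, g y ∂μ) + r < g x} ≤
            EReal.exp (-(TransportInformation.alphaTilde α r : EReal)) := by
  open TransportInformation in
  -- If Z = 0, the formula for the Gibbs measure gives the zero measure, relative to which every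
  -- probability measure has infinite entropy. Otherwise μ is a probability measure.
  rcases eq_or_ne (partitionFunction n V) 0 with hZ0 | hZ0
  · have hμ0 : μ = 0 := by
      have h : (riemannianVolume n M).withDensity
          (fun x => ENNReal.ofReal (Real.exp (-V x))) = 0 := by
        rw [← Measure.measure_univ_eq_zero, withDensity_apply _ MeasurableSet.univ,
          Measure.restrict_univ]
        exact hZ0
      rw [hμ, gibbsMeasure, h, smul_zero]
    subst hμ0
    refine ⟨fun ν hν => ?_, fun g hg => ⟨fun _ => integrable_zero_measure, fun r hr => by simp⟩⟩
    rw [InformationTheory.klDiv_zero_right]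
    exact le_top
  have hprob : IsProbabilityMeasure μ := by
    refine ⟨?_⟩
    rw [hμ, gibbsMeasure, Measure.smul_apply, withDensity_apply _ MeasurableSet.univ,
      Measure.restrict_univ, smul_eq_mul]
    exact ENNReal.inv_mul_cancel hZ0 hZ
  have : LocallyCompactSpace M :=
    ChartedSpace.locallyCompactSpace (EuclideanSpace ℝ (Fin n)) M
  have : ProperSpace M := properSpace_of_hasApproxIntermediatePoints
    (hasApproxIntermediatePoints_of_isRiemannianManifold (𝓡 n))
  have hH := satisfiesW1H_alphaTilde hα_mono hW1I
  have hI : (∃ r, α r ≠ 0) → ∀ g : M → ℝ, LipschitzWith 1 g → Integrable g μ :=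
    fun ⟨r, hr⟩ g hg => integrable_of_lipschitz (n := n)
      (extendTop_top_of_convex hα_conv hα_zero hr) hW1I hg
  refine ⟨hH, fun g hg => ⟨fun h => hI h g hg, fun r _ => ?_⟩⟩
  -- If α vanishes identically, g may fail to be integrable, but then α̃ = 0 and the right-hand side
  -- is 1.
  by_cases h : ∃ r, α r ≠ 0
  · exact measure_integral_add_lt_le alphaTilde_mono hH hg (hI h g hg) r
  · push Not at h
    simpa [alphaTilde, h] using prob_le_one
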